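/- **Setting.** A congestion game has $n$ agents, a finite set $E$ of $m$ resources, for each agent $i$ a non-empty set $\mathcal P_i\subseteq 2^E$ of strategies, and for each resource $e$ a nonnegative non-decreasing cost function $c_e:\mathbb N\to\mathbb R_{\ge 0}$. Let $c_{\max}=\max_{e} c_e(n)$. For a profile $p=(p_1,\dots,p_n)$ let $\ell_e(p)=|\{i: e\in p_i\}|$ and $C_i(p)=\sum_{e\in p_i}c_e(\ell_e(p))$; for mixed strategies $\pi_i\in\Delta(\mathcal P_i)$ let $c_i(\pi_i,\pi_{-i})$ be the expectation of $C_i(p)$ when the $p_j\sim\pi_j$ are independent. Let $E_i=\bigcup_{p_i\in\mathcal P_i}p_i$, $m_i=|E_i|$, let $\mathcal X_i\subseteq[0,1]^E$ be the convex hull of the $0/1$ indicator vectors of the strategies in $\mathcal P_i$, and $\mathcal X_i^{\mu}=\{x\in\mathcal X_i: x_e\ge\mu\ \ \forall e\in E_i\}$. A Carathéodory decomposition of $x\in\mathcal X_i$ is a distribution $\pi\in\Delta(\mathcal P_i)$ with support of size at most $m+1$ such that $x_e=\Pr_{p\sim\pi}[e\in p]$ for all $e\in E$. **Algorithm** (step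 sizes $\gamma_t$, exploration parameters $\mu_{i,t}$). Each agent $i$ starts at an arbitrary $x_i^1\in\mathcal X_i^{\mu_{i,1}}$. In round $t=1,\dots,T$ she computes an arbitrary Carathéodory decomposition $\pi_i^t$ of $x_i^t$ and samples $p_i^t\sim\pi_i^t$, independently of the other agents given the past; with $c^t_e=c_e(\ell_e(p^t))$ she sets $\hat c^t_{i,e}=c^t_e\,\mathbf 1[e\in p_i^t]/x^t_{i,e}$ (zero if $e\notin p_i^t$), and, with $\Pi$ the Euclidean projection, $$x_i^{t+1}=\Pi_{\mathcal X_i^{\mu_{i,t+1}}}\big[x_i^t-\gamma_t\,\hat c_i^t\big].$$ **Theorem.** Let $C\in\mathbb R$. 1. There is a constant $K>0$, depending only on $C$, such that for every congestion game with $c_{\max}\le C$, every $\varepsilon>0$ and every $T\ge K\,m^{12.5}n^{7.5}/\varepsilon^5$: if all agents run the algorithm with $\gamma_t=t^{-3/5}$ and $\mu_{i,t}=\min(1/m_i,\,t^{-1/5})$, then $$\frac1T\,\mathbb E\left[\sum_{t=1}^T\max_{i\in[n]}\Big(c_i(\pi_i^t,\pi_{-i}^t)-\min_{\pi_i\in\Delta(\mathcal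 P_i)}c_i(\pi_i,\pi_{-i}^t)\Big)\right]\le\varepsilon .$$ 2. For all $a,b>0$ there is a constant $K>0$, depending only on $a,b,C$, such that for every congestion game with $c_{\max}\le C$, every $\varepsilon>0$ and every $T\ge K\,n^{6.5}m^{7}/\varepsilon^5$, the same bound holds if all agents run the algorithm with $\gamma_t=a\,m^{-4/5}n^{-8/5}c_{\max}^{-1}t^{-3/5}$ and $\mu_{i,t}=\min\big(1/m_i,\ b\,n^{-6/5}m^{-11/10}t^{-1/5}\big)$. (For $b\le1$ the minimum is the second term.) -/

import Mathlib

open MeasureTheory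

universe u v

noncomputable section

/-- A congestion game with `n` agents and set of resources `E`: every agent has a non-empty finite
set of strategies, each of which is a set of resources, and every resource has a nonnegative
nondecreasing cost function of its load. -/
structure CongestionGame (n : ℕ) (E : Type u) where
  strategies : Fin n → Finset (Finset E)
  strategies_nonempty : ∀ i, (strategies i).Nonempty
  cost : E → ℕ → ℝ
  cost_nonneg : ∀ e k, 0 ≤ cost e k
  cost_mono : ∀ e, Monotone (cost e)

namespace CongestionGame

variable {n : ℕ} {E : Type u} [Fintype E] [DecidableEq E] (G : CongestionGame n E)

/-- The pure strategies of agent `i`, as a type. -/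
abbrev Strategy (i : Fin n) : Type u := {s : Finset E // s ∈ G.strategies i}

/-- Joint pure strategy profiles. -/
abbrev Profile : Type u := (i : Fin n) → G.Strategy i

/-- Profiles of weights on the pure strategies; a mixed profile is one whose components all lie in
the standard simplices. -/
abbrev MixedProfile : Type u := (i : Fin n) → G.Strategy i → ℝ

/-- The maximal cost `max_e c_e(n)`. -/
def cmax : ℝ := ⨆ e : E, G.cost e n

/-- The number of agents that use the resource `e`. -/
def load (q : G.Profile) (e : E) : ℕ := (Finset.univ.filter fun i => e ∈ (q i).1).card

/-- The cost of agent `i` under a pure profile. -/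
def agentCost (i : Fin n) (q : G.Profile) : ℝ := ∑ e ∈ (q i).1, G.cost e (G.load q e)

/-- The expected cost of agent `i` when the agents draw their strategies independently. -/
def expectedCost (i : Fin n) (π : G.MixedProfile) : ℝ :=
  ∑ q : G.Profile, (∏ j, π j (q j)) * G.agentCost i q

/-- The largest gain that an agent can make by deviating unilaterally to another mixed strategy. -/
def exploitability (π : G.MixedProfile) : ℝ :=
  ⨆ i : Fin n, (G.expectedCost i π -
    ⨅ σ : stdSimplex ℝ (G.Strategy i), G.expectedCost i (Function.update π i σ.1))

/-- The resources that occur in some strategy of agent `i`. -/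
def activeResources (i : Fin n) : Finset E := (G.strategies i).biUnion id

/-- The 0/1 vector of a set of resources. -/
def indicatorVec (s : Finset E) : EuclideanSpace ℝ E :=
  WithLp.toLp 2 fun e => if e ∈ s then 1 else 0

/-- The polytope of agent `i`: the convex hull of the 0/1 vectors of her strategies. -/
def polytope (i : Fin n) : Set (EuclideanSpace ℝ E) :=
  convexHull ℝ (indicatorVec '' (G.strategies i : Set (Finset E)))

/-- The bounded-away polytope with exploration parameter `μ`. -/
def boundedAwayPolytope (i : Fin n) (μ : ℝ) : Set (EuclideanSpace ℝ E) :=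
  {x | x ∈ G.polytope i ∧ ∀ e ∈ G.activeResources i, μ ≤ x e}

/-- `y` is the Euclidean projection of `z` on `S`. -/
def IsProjection (S : Set (EuclideanSpace ℝ E)) (z y : EuclideanSpace ℝ E) : Prop :=
  y ∈ S ∧ ∀ w ∈ S, ‖z - y‖ ≤ ‖z - w‖

/-- `σ` is a Carathéodory decomposition of `x`: a probability distribution on the strategies of
agent `i`, with at most `|E| + 1` strategies in its support, under which each resource `e` is
selected with probability `x e`. -/
def IsCaratheodoryDecomposition (i : Fin n) (x : EuclideanSpace ℝ E) (σ : G.Strategy i → ℝ) :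
    Prop :=
  σ ∈ stdSimplex ℝ (G.Strategy i) ∧
  (Finset.univ.filter fun s => σ s ≠ 0).card ≤ Fintype.card E + 1 ∧
  ∀ e, x e = ∑ s : G.Strategy i, if e ∈ s.1 then σ s else 0

/-- The cost estimate `ĉ` of agent `i` from semi-bandit feedback, when `x` is her fractional
selection and `q` the realized profile: `c_e · 1[e ∈ q i] / x e`. -/
def costEstimate (i : Fin n) (x : EuclideanSpace ℝ E) (q : G.Profile) : EuclideanSpace ℝ E :=
  WithLp.toLp 2 fun e => if e ∈ (q i).1 then G.cost e (G.load q e) / x e else 0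

/-- All agents run online gradient descent with Carathéodory exploration for the rounds
`1, …, T`, with step sizes `γ t` and exploration parameters `μ i t`.
Here `x t ω i` is the fractional selection of agent `i` in round `t`, `π t ω i` the Carathéodory
decomposition that she computes, and `p t ω i` the strategy that she samples. The σ-algebra `ℱ t`
is the information available just before the strategies of round `t` are sampled; given it, the
agents sample independently, agent `i` from `π t ω i`. The initial points and the decompositions
are otherwise arbitrary. -/
structure IsRun (γ : ℕ → ℝ) (μ : Fin n → ℕ → ℝ) (T : ℕ)
    {Ω : Type v} [mΩ : MeasurableSpace Ω] (P : Measure Ω) (ℱ : Filtration ℕ mΩ)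
    (x : ℕ → Ω → Fin n → EuclideanSpace ℝ E) (π : ℕ → Ω → G.MixedProfile)
    (p : ℕ → Ω → G.Profile) : Prop where
  measurable_x : ∀ t, 1 ≤ t → t ≤ T → Measurable[ℱ t] (x t)
  measurable_π : ∀ t, 1 ≤ t → t ≤ T → Measurable[ℱ t] (π t)
  measurable_p : ∀ t, 1 ≤ t → t ≤ T → ∀ q, MeasurableSet[ℱ (t + 1)] {ω | p t ω = q}
  initial : 1 ≤ T → ∀ ω i, x 1 ω i ∈ G.boundedAwayPolytope i (μ i 1)
  decomposition : ∀ t, 1 ≤ t → t ≤ T → ∀ ω i,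
    G.IsCaratheodoryDecomposition i (x t ω i) (π t ω i)
  sampling : ∀ t, 1 ≤ t → t ≤ T → ∀ q : G.Profile,
    P[({ω | p t ω = q}).indicator (fun _ => (1 : ℝ)) | ℱ t] =ᵐ[P] fun ω => ∏ i, π t ω i (q i)
  update : ∀ t, 1 ≤ t → t < T → ∀ ω i,
    IsProjection (G.boundedAwayPolytope i (μ i (t + 1)))
      (x t ω i - γ t • G.costEstimate i (x t ω i) (p t ω)) (x (t + 1) ω i)

/-- The step sizes `t^(-3/5)`. -/
def stepSize (t : ℕ) : ℝ := (t : ℝ) ^ (-(3 / 5) : ℝ)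

/-- The exploration parameters `min (1 / |E_i|) t^(-1/5)`. -/
def exploration (i : Fin n) (t : ℕ) : ℝ :=
  min (1 / ((G.activeResources i).card : ℝ)) ((t : ℝ) ^ (-(1 / 5) : ℝ))

/-- The tuned step sizes `a · m^(-4/5) n^(-8/5) cmax⁻¹ t^(-3/5)`. -/
def tunedStepSize (a : ℝ) (t : ℕ) : ℝ :=
  a * (Fintype.card E : ℝ) ^ (-(4 / 5) : ℝ) * (n : ℝ) ^ (-(8 / 5) : ℝ) * G.cmax⁻¹ *
    (t : ℝ) ^ (-(3 / 5) : ℝ)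

/-- The tuned exploration parameters `b · n^(-6/5) m^(-11/10) t^(-1/5)`, capped at `1 / |E_i|` so
that the bounded-away polytope is non-empty (for `b ≤ 1` the cap has no effect). -/
def tunedExploration (b : ℝ) (i : Fin n) (t : ℕ) : ℝ :=
  min (1 / ((G.activeResources i).card : ℝ))
    (b * (n : ℝ) ^ (-(6 / 5) : ℝ) * (Fintype.card E : ℝ) ^ (-(11 / 10) : ℝ) *
      (t : ℝ) ^ (-(1 / 5) : ℝ))

/-- The expected time-averaged exploitability of the profiles `π 1, …, π T` is well defined (the
sum is integrable) and at most `ε`. -/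
def AvgExploitabilityLE {Ω : Type v} [MeasurableSpace Ω] (P : Measure Ω)
    (π : ℕ → Ω → G.MixedProfile) (T : ℕ) (ε : ℝ) : Prop :=
  Integrable (fun ω => ∑ t ∈ Finset.Icc 1 T, G.exploitability (π t ω)) P ∧
  (1 / (T : ℝ)) * ∫ ω, ∑ t ∈ Finset.Icc 1 T, G.exploitability (π t ω) ∂P ≤ ε

end CongestionGame

end

set_option linter.unusedSectionVars false

noncomputable section

/-! The expected costs depend on a mixed profile only through its marginals `x i e`. Extended
multilinearly to marginals, Rosenthal's potential Φ is affine in each agent's block, and its partial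
derivatives are the `marginalCost`s (`potential_update`). So the agents jointly run stochastic
projected gradient descent on Φ, with noisy gradients `costEstimate`.

Φ is not convex, but its gradient g satisfies ⟨x - y, g(x) - g(y)⟩ ≥ -L‖x - y‖² with L = n · cmax.
Progress is therefore measured by the Moreau envelope, the minimum over feasible y of Φ(y) + L‖x -
y‖². If y attains it at x, optimality of y gives ⟨x - y, g(x)⟩ ≥ L‖x - y‖² (`envelope_descent`).
Keeping y as a competitor after the step shows that the expected envelope drops by at least 2γL²‖x -
y‖² minus γ² times the variance term (`sum_envelope_gradientStep_le`); projection does not raise it.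

The same y controls incentives: no deviation from x gains more than 4L√m‖x - y‖ plus an exploration
error m² · cmax · τ (`deviation_gain_le`). By the inequality A ≤ 1/(4η) + ηA² the exploitability is
bounded by an expression affine in the envelope decrease (`exploitability_le_envelope_decrease`), so
expectations can be taken directly. Weighted telescoping (`Finset.sum_Icc_sub_div_le`) then bounds
the expected total (`IsRun.sum_integral_exploitability_le`). With γ of order t^(-3/5) and τ of order
t^(-1/5) all errors balance at T^(-1/5) on average (`IsRun.avgExploitabilityLE_of_rpow`), and only
the bookkeeping of powers of n and m is left. -/

/-! ### Multilinear extensions of set functions -/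

/-- The expectation of `F A`, where `A ⊆ s` contains every `j ∈ s` independently with
probability `y j`. -/
def multilinearExt {ι : Type*} [DecidableEq ι] (s : Finset ι) (F : Finset ι → ℝ) (y : ι → ℝ) : ℝ :=
  ∑ A ∈ s.powerset, ((∏ j ∈ A, y j) * ∏ j ∈ s \ A, (1 - y j)) * F A

section MultilinearExt

variable {ι : Type*} [DecidableEq ι] {s : Finset ι} {F : Finset ι → ℝ} {y z : ι → ℝ} {c : ℝ}

/-- Conditioning on whether `j` is in the random set. This recursion drives the inductions below and
isolates the dependence on a single agent. -/
theorem multilinearExt_insert {j : ι} (hj : j ∉ s) (F : Finset ι → ℝ) (y : ι → ℝ) :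
    multilinearExt (insert j s) F y =
      y j * multilinearExt s (fun A => F (insert j A)) y + (1 - y j) * multilinearExt s F y := by
  unfold multilinearExt
  rw [Finset.sum_powerset_insert hj, Finset.mul_sum, Finset.mul_sum, add_comm]
  congr 1
  · refine Finset.sum_congr rfl fun A hA => ?_
    have hA' := Finset.mem_powerset.1 hA
    have hjA : j ∉ A := fun h => hj (hA' h)
    have h1 : insert j s \ insert j A = s \ A := by
      ext k; simp only [Finset.mem_sdiff, Finset.mem_insert]
      constructor
      · tauto
      · rintro ⟨h, h'⟩
        exact ⟨Or.inr h, fun h2 => h2.elim (fun h3 => hj (h3 ▸ h)) h'⟩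
    rw [h1, Finset.prod_insert hjA]; ring
  · refine Finset.sum_congr rfl fun A hA => ?_
    have hA' := Finset.mem_powerset.1 hA
    have hjA : j ∉ A := fun h => hj (hA' h)
    rw [Finset.insert_sdiff_of_notMem _ hjA, Finset.prod_insert (by simp [hj])]; ring

theorem multilinearExt_congr {F' : Finset ι → ℝ} (hF : ∀ A ⊆ s, F A = F' A)
    (hy : ∀ j ∈ s, y j = z j) : multilinearExt s F y = multilinearExt s F' z := by
  refine Finset.sum_congr rfl fun A hA => ?_
  have hA' := Finset.mem_powerset.1 hA
  have h1 : ∏ j ∈ A, y j = ∏ j ∈ A, z j := Finset.prod_congr rfl fun j hj => hy j (hA' hj)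
  have h2 : ∏ j ∈ s \ A, (1 - y j) = ∏ j ∈ s \ A, (1 - z j) :=
    Finset.prod_congr rfl fun j hj => by rw [hy j (Finset.mem_sdiff.1 hj).1]
  rw [hF A hA', h1, h2]

theorem multilinearExt_sub (s : Finset ι) (F F' : Finset ι → ℝ) (y : ι → ℝ) :
    multilinearExt s (fun A => F A - F' A) y = multilinearExt s F y - multilinearExt s F' y := by
  simp only [multilinearExt, mul_sub, Finset.sum_sub_distrib]

theorem continuous_multilinearExt {X : Type*} [TopologicalSpace X] (s : Finset ι)
    (F : Finset ι → ℝ) {f : X → ι → ℝ} (hf : ∀ j, Continuous fun x => f x j) :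
    Continuous fun x => multilinearExt s F (f x) := by
  unfold multilinearExt
  fun_prop

theorem multilinearExt_mem_Icc (hF : ∀ A, F A ∈ Set.Icc 0 c) (hy : ∀ j, y j ∈ Set.Icc (0 : ℝ) 1) :
    multilinearExt s F y ∈ Set.Icc 0 c := by
  induction s using Finset.induction_on generalizing F with
  | empty => simpa [multilinearExt] using hF ∅
  | insert j s hj ih =>
    rw [multilinearExt_insert hj]
    have h1 := ih (F := fun A => F (insert j A)) fun A => hF _
    have h2 := ih hF
    have h3 := hy j
    simp only [Set.mem_Icc] at *
    constructor
    · have := mul_nonneg h3.1 h1.1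
      have := mul_nonneg (sub_nonneg.2 h3.2) h2.1
      linarith
    · have := mul_le_mul_of_nonneg_left h1.2 h3.1
      have := mul_le_mul_of_nonneg_left h2.2 (sub_nonneg.2 h3.2)
      linarith

/-- Coordinates are exchanged one at a time. Each exchange is affine with slope a difference of two
values in `[0, c]`, which is why the constant is `c` and not `2 * c`. -/
theorem abs_multilinearExt_sub_le (hF : ∀ A, F A ∈ Set.Icc 0 c)
    (hy : ∀ j, y j ∈ Set.Icc (0 : ℝ) 1) (hz : ∀ j, z j ∈ Set.Icc (0 : ℝ) 1) :
    |multilinearExt s F y - multilinearExt s F z| ≤ c * ∑ j ∈ s, |y j - z j| := by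
  induction s using Finset.induction_on generalizing F with
  | empty => simp [multilinearExt]
  | insert j s hj ih =>
    rw [multilinearExt_insert hj, multilinearExt_insert hj, Finset.sum_insert hj]
    have h1 := ih (F := fun A => F (insert j A)) fun A => hF _
    have h2 := ih hF
    have b1 := multilinearExt_mem_Icc (s := s) (F := fun A => F (insert j A)) (fun A => hF _) hy
    have b2 := multilinearExt_mem_Icc (s := s) hF hy
    have h3 := hz j
    set p := multilinearExt s (fun A => F (insert j A)) y
    set q := multilinearExt s F y
    set p' := multilinearExt s (fun A => F (insert j A)) z
    set q' := multilinearExt s F z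
    set D := c * ∑ j ∈ s, |y j - z j|
    simp only [Set.mem_Icc] at *
    have e : y j * p + (1 - y j) * q - (z j * p' + (1 - z j) * q') =
        (y j - z j) * (p - q) + (z j * (p - p') + (1 - z j) * (q - q')) := by ring
    have hpq : |p - q| ≤ c := abs_le.2 ⟨by linarith, by linarith⟩
    have t1 : |(y j - z j) * (p - q)| ≤ c * |y j - z j| := by
      rw [abs_mul, mul_comm c]; exact mul_le_mul_of_nonneg_left hpq (abs_nonneg _)
    have t2 : |z j * (p - p')| ≤ z j * D := by
      rw [abs_mul, abs_of_nonneg h3.1]; exact mul_le_mul_of_nonneg_left h1 h3.1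
    have t3 : |(1 - z j) * (q - q')| ≤ (1 - z j) * D := by
      rw [abs_mul, abs_of_nonneg (sub_nonneg.2 h3.2)]
      exact mul_le_mul_of_nonneg_left h2 (sub_nonneg.2 h3.2)
    rw [e]
    calc _ ≤ |(y j - z j) * (p - q)| + |z j * (p - p') + (1 - z j) * (q - q')| := abs_add_le _ _
      _ ≤ c * |y j - z j| + (|z j * (p - p')| + |(1 - z j) * (q - q')|) := by
          gcongr; exact abs_add_le _ _
      _ ≤ c * (|y j - z j| + ∑ j ∈ s, |y j - z j|) := by
          have : c * (|y j - z j| + ∑ j ∈ s, |y j - z j|) = c * |y j - z j| + D := by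
            simp only [D]; ring
          linarith

end MultilinearExt

/-! ### Marginals and the multilinear extension of Rosenthal's potential. -/

namespace CongestionGame

variable {n : ℕ} {E : Type u} [Fintype E] [DecidableEq E] (G : CongestionGame n E)

/-- A vector of marginal probabilities for every agent. -/
abbrev Marginals (n : ℕ) (E : Type u) : Type u := Fin n → EuclideanSpace ℝ E

theorem cost_le_cmax (e : E) {k : ℕ} (hk : k ≤ n) : G.cost e k ≤ G.cmax :=
  (G.cost_mono e hk).trans (le_ciSup (f := fun e => G.cost e n) (Finite.bddAbove_range _) e)

theorem cmax_nonneg : 0 ≤ G.cmax := Real.iSup_nonneg fun e => G.cost_nonneg e n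

theorem cost_card_mem (e : E) (A : Finset (Fin n)) : G.cost e A.card ∈ Set.Icc 0 G.cmax :=
  ⟨G.cost_nonneg _ _, G.cost_le_cmax e (by simpa using A.card_le_univ)⟩

/-- The expected cost of the resource `e` for agent `i` when she uses it, and the others use it
independently with probabilities `x j e`. -/
def marginalCost (x : Marginals n E) (i : Fin n) (e : E) : ℝ :=
  multilinearExt (Finset.univ.erase i) (fun A => G.cost e (insert i A).card) fun j => x j e

/-- The multilinear extension of Rosenthal's potential. -/
def potential (x : Marginals n E) : ℝ :=
  ∑ e, multilinearExt Finset.univ (fun A => ∑ k ∈ Finset.range A.card, G.cost e (k + 1))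
    fun j => x j e

/-- All coordinates lie in the unit interval. -/
def InUnitCube (x : Marginals n E) : Prop := ∀ i e, x i e ∈ Set.Icc (0 : ℝ) 1

theorem marginalCost_mem {x : Marginals n E} (hx : InUnitCube x) (i : Fin n) (e : E) :
    G.marginalCost x i e ∈ Set.Icc 0 G.cmax :=
  multilinearExt_mem_Icc (fun _ => G.cost_card_mem e _) fun j => hx j e

theorem abs_marginalCost_sub_le {x y : Marginals n E} (hx : InUnitCube x) (hy : InUnitCube y)
    (i : Fin n) (e : E) :
    |G.marginalCost x i e - G.marginalCost y i e| ≤ G.cmax * ∑ j, |x j e - y j e| := by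
  refine (abs_multilinearExt_sub_le (fun A => G.cost_card_mem e _) (fun j => hx j e)
    fun j => hy j e).trans ?_
  refine mul_le_mul_of_nonneg_left ?_ G.cmax_nonneg
  exact Finset.sum_le_sum_of_subset_of_nonneg (Finset.subset_univ _) fun _ _ _ => abs_nonneg _

theorem continuous_potential : Continuous fun x : Marginals n E => G.potential x := by
  unfold potential
  refine continuous_finsetSum _ fun e _ => continuous_multilinearExt _ _ fun j => ?_
  fun_prop

theorem potential_mem {x : Marginals n E} (hx : InUnitCube x) :
    G.potential x ∈ Set.Icc 0 (n * Fintype.card E * G.cmax) := by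
  have h : ∀ e, multilinearExt Finset.univ (fun A => ∑ k ∈ Finset.range A.card, G.cost e (k + 1))
      (fun j => x j e) ∈ Set.Icc 0 (n * G.cmax) := fun e => by
    refine multilinearExt_mem_Icc (fun A => ⟨Finset.sum_nonneg fun k _ => G.cost_nonneg _ _, ?_⟩)
      fun j => hx j e
    have hA : A.card ≤ n := by simpa using A.card_le_univ
    calc _ ≤ ∑ k ∈ Finset.range A.card, G.cmax := Finset.sum_le_sum fun k hk =>
          G.cost_le_cmax e (by have := Finset.mem_range.1 hk; omega)
      _ = A.card * G.cmax := by simp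
      _ ≤ _ := by
          have := G.cmax_nonneg
          gcongr
  refine ⟨Finset.sum_nonneg fun e _ => (h e).1, ?_⟩
  refine (Finset.sum_le_sum fun e _ => (h e).2).trans_eq ?_
  simp; ring

theorem marginalCost_update (x : Marginals n E) (i : Fin n) (y : EuclideanSpace ℝ E) (e : E) :
    G.marginalCost (Function.update x i y) i e = G.marginalCost x i e :=
  multilinearExt_congr (fun _ _ => rfl) fun j hj => by
    rw [Function.update_of_ne (Finset.ne_of_mem_erase hj)]

/-- Adding agent `i` to a set of users raises Rosenthal's sum by exactly the cost she then pays.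
Conditioning on `i` thus splits off a term linear in `x i` whose coefficients, like the remainder,
do not involve `x i`. -/
theorem potential_eq (x : Marginals n E) (i : Fin n) :
    G.potential x = ∑ e, (x i e * G.marginalCost x i e +
      multilinearExt (Finset.univ.erase i) (fun A => ∑ k ∈ Finset.range A.card, G.cost e (k + 1))
        fun j => x j e) := by
  refine Finset.sum_congr rfl fun e _ => ?_
  have h : G.marginalCost x i e = multilinearExt (Finset.univ.erase i)
      (fun A => ∑ k ∈ Finset.range (insert i A).card, G.cost e (k + 1) -
        ∑ k ∈ Finset.range A.card, G.cost e (k + 1)) fun j => x j e := by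
    refine multilinearExt_congr (fun A hA => ?_) fun _ _ => rfl
    have hi : i ∉ A := fun h => by simpa using hA h
    rw [Finset.card_insert_of_notMem hi, Finset.sum_range_succ]; ring
  rw [h, multilinearExt_sub]
  conv_lhs => rw [← Finset.insert_erase (Finset.mem_univ i)]
  rw [multilinearExt_insert (Finset.notMem_erase _ _)]
  ring

/-- The potential is affine in the marginals of each agent. -/
theorem potential_update (x : Marginals n E) (i : Fin n) (y : EuclideanSpace ℝ E) :
    G.potential (Function.update x i y) =
      G.potential x + ∑ e, (y e - x i e) * G.marginalCost x i e := by
  rw [G.potential_eq _ i, G.potential_eq x i, ← Finset.sum_add_distrib]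
  refine Finset.sum_congr rfl fun e _ => ?_
  rw [G.marginalCost_update, Function.update_self]
  have : multilinearExt (Finset.univ.erase i)
      (fun A => ∑ k ∈ Finset.range A.card, G.cost e (k + 1))
      (fun j => Function.update x i y j e) = multilinearExt (Finset.univ.erase i)
      (fun A => ∑ k ∈ Finset.range A.card, G.cost e (k + 1)) (fun j => x j e) :=
    multilinearExt_congr (fun _ _ => rfl) fun j hj => by
      rw [Function.update_of_ne (Finset.ne_of_mem_erase hj)]
  rw [this]; ring

/-- The marginals of a mixed strategy. -/
def marginal {i : Fin n} (σ : G.Strategy i → ℝ) : EuclideanSpace ℝ E :=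
  WithLp.toLp 2 fun e => ∑ s : G.Strategy i, if e ∈ s.1 then σ s else 0

theorem marginal_apply {i : Fin n} (σ : G.Strategy i → ℝ) (e : E) :
    G.marginal σ e = ∑ s : G.Strategy i, if e ∈ s.1 then σ s else 0 := rfl

/-- The set of users of a resource. -/
def users (q : G.Profile) (e : E) : Finset (Fin n) := Finset.univ.filter fun i => e ∈ (q i).1

/-- Under a product distribution, the expectation of a function of the set of users of a resource
is the multilinear extension at the marginals. -/
theorem sum_profile_users {π : G.MixedProfile} (hπ : ∀ i, ∑ s, π i s = 1) (e : E)
    (F : Finset (Fin n) → ℝ) :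
    ∑ q : G.Profile, (∏ j, π j (q j)) * F (G.users q e) =
      multilinearExt Finset.univ F fun j => G.marginal (π j) e := by
  classical
  have h0 : ∀ A : Finset (Fin n), ∑ q : G.Profile with G.users q e = A, ∏ j, π j (q j) =
      (∏ j ∈ A, G.marginal (π j) e) * ∏ j ∈ Finset.univ \ A, (1 - G.marginal (π j) e) := by
    intro A
    -- Prescribing the users of `e` is a separate constraint on each agent, so the event is a
    -- product set and its probability factorizes.
    have h1 : (Finset.univ.filter fun q : G.Profile => G.users q e = A) =
        Fintype.piFinset fun j => Finset.univ.filter fun s : G.Strategy j => (e ∈ s.1 ↔ j ∈ A) := by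
      ext q
      simp [Finset.ext_iff, users]
    rw [h1, ← Finset.prod_univ_sum, ← Finset.compl_eq_univ_sdiff, ← Finset.prod_mul_prod_compl A]
    congr 1
    · refine Finset.prod_congr rfl fun j hj => ?_
      simp [hj, marginal_apply, Finset.sum_filter]
    · refine Finset.prod_congr rfl fun j hj => ?_
      have hj' : j ∉ A := by simpa using hj
      rw [← hπ j, marginal_apply, ← Finset.sum_sub_distrib, Finset.sum_filter]
      refine Finset.sum_congr rfl fun s _ => ?_
      by_cases h : e ∈ s.1 <;> simp [h, hj']
  unfold multilinearExt
  rw [Finset.powerset_univ, ← Finset.sum_fiberwise Finset.univ (fun q => G.users q e)]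
  refine Finset.sum_congr rfl fun A _ => ?_
  rw [← h0 A, Finset.sum_mul]
  refine Finset.sum_congr rfl fun q hq => ?_
  rw [(Finset.mem_filter.1 hq).2]

theorem sum_profile_cost {π : G.MixedProfile} (hπ : ∀ i, ∑ s, π i s = 1) (i : Fin n) (e : E)
    {x : Marginals n E} (hx : ∀ j e, x j e = G.marginal (π j) e) :
    ∑ q : G.Profile, (∏ j, π j (q j)) * (if e ∈ (q i).1 then G.cost e (G.load q e) else 0) =
      x i e * G.marginalCost x i e := by
  have h := G.sum_profile_users hπ e fun A => if i ∈ A then G.cost e A.card else 0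
  have h1 : ∀ q : G.Profile, (if i ∈ G.users q e then G.cost e (G.users q e).card else 0) =
      if e ∈ (q i).1 then G.cost e (G.load q e) else 0 := fun q => by
    simp [users, load]
  simp only [h1] at h
  rw [h, ← Finset.insert_erase (Finset.mem_univ i),
    multilinearExt_insert (Finset.notMem_erase _ _)]
  have h2 : multilinearExt (Finset.univ.erase i) (fun A => if i ∈ A then G.cost e A.card else 0)
      (fun j => G.marginal (π j) e) = 0 := by
    refine Finset.sum_eq_zero fun A hA => ?_
    have hi : i ∉ A := fun h => by simpa using Finset.mem_powerset.1 hA h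
    simp [hi]
  rw [h2]
  simp [marginalCost, hx]

/-- The expected cost of an agent in terms of marginals. -/
theorem expectedCost_eq {π : G.MixedProfile} (hπ : ∀ i, ∑ s, π i s = 1) (i : Fin n)
    {x : Marginals n E} (hx : ∀ j e, x j e = G.marginal (π j) e) :
    G.expectedCost i π = ∑ e, x i e * G.marginalCost x i e := by
  simp only [← G.sum_profile_cost hπ i _ hx]
  rw [Finset.sum_comm]
  refine Finset.sum_congr rfl fun q _ => ?_
  rw [← Finset.mul_sum, agentCost, Finset.sum_ite_mem, Finset.univ_inter]

end CongestionGame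

namespace CongestionGame

variable {n : ℕ} {E : Type u} [Fintype E] [DecidableEq E] (G : CongestionGame n E)

/-! ### The polytopes -/

theorem indicatorVec_apply (s : Finset E) (e : E) :
    indicatorVec s e = if e ∈ s then (1 : ℝ) else 0 := rfl

theorem mem_activeResources {i : Fin n} {s : Finset E} (hs : s ∈ G.strategies i) {e : E}
    (he : e ∈ s) : e ∈ G.activeResources i :=
  Finset.mem_biUnion.2 ⟨s, hs, he⟩

theorem polytope_coord {i : Fin n} {y : EuclideanSpace ℝ E} (hy : y ∈ G.polytope i) (e : E) :
    y e ∈ Set.Icc (0 : ℝ) 1 ∧ (e ∉ G.activeResources i → y e = 0) := by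
  have h : G.polytope i ⊆
      {y | y e ∈ Set.Icc (0 : ℝ) 1 ∧ (e ∉ G.activeResources i → y e = 0)} := by
    refine convexHull_min ?_ ?_
    · rintro _ ⟨s, hs, rfl⟩
      refine ⟨?_, fun he => ?_⟩
      · rw [indicatorVec_apply]; split_ifs <;> simp
      · rw [indicatorVec_apply, if_neg fun h => he (G.mem_activeResources hs h)]
    · intro y hy z hz a b ha hb hab
      refine ⟨convex_Icc (0 : ℝ) 1 hy.1 hz.1 ha hb hab, fun he => ?_⟩
      simp [hy.2 he, hz.2 he]
  exact h hy

theorem isCompact_polytope (i : Fin n) : IsCompact (G.polytope i) :=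
  Set.Finite.isCompact_convexHull (𝕜 := ℝ) ((G.strategies i).finite_toSet.image _)

theorem convex_boundedAwayPolytope (i : Fin n) (ν : ℝ) :
    Convex ℝ (G.boundedAwayPolytope i ν) := by
  intro y hy z hz a b ha hb hab
  refine ⟨convex_convexHull ℝ _ hy.1 hz.1 ha hb hab, fun e he => ?_⟩
  exact convex_Ici ν (hy.2 e he) (hz.2 e he) ha hb hab

theorem isCompact_boundedAwayPolytope (i : Fin n) (ν : ℝ) :
    IsCompact (G.boundedAwayPolytope i ν) := by
  refine (G.isCompact_polytope i).inter_right (t := {x | ∀ e ∈ G.activeResources i, ν ≤ x e}) ?_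
  simp only [Set.ofPred_forall]
  refine isClosed_iInter fun e => isClosed_iInter fun _ => isClosed_le continuous_const ?_
  fun_prop

theorem boundedAwayPolytope_anti (i : Fin n) {ν ν' : ℝ} (h : ν ≤ ν') :
    G.boundedAwayPolytope i ν' ⊆ G.boundedAwayPolytope i ν :=
  fun _ hx => ⟨hx.1, fun e he => h.trans (hx.2 e he)⟩

theorem marginal_mem_polytope {i : Fin n} {σ : G.Strategy i → ℝ}
    (hσ : σ ∈ stdSimplex ℝ (G.Strategy i)) : G.marginal σ ∈ G.polytope i := by
  have h : G.marginal σ = ∑ s, σ s • indicatorVec s.1 := by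
    ext e
    simp [marginal_apply, indicatorVec_apply]
  rw [h]
  exact (convex_convexHull ℝ _).sum_mem (fun s _ => hσ.1 s) hσ.2
    fun s _ => subset_convexHull ℝ _ ⟨s.1, s.2, rfl⟩

/-- The largest exploration parameter of agent `i` that is at most `τ` and leaves the bounded-away
polytope non-empty. -/
def cappedExploration (τ : ℝ) (i : Fin n) : ℝ :=
  min (1 / ((G.activeResources i).card : ℝ)) τ

section Exploration

variable {τ : ℝ} {i : Fin n} {e : E}

theorem card_activeResources_le (i : Fin n) : ((G.activeResources i).card : ℝ) ≤ Fintype.card E :=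
  by exact_mod_cast Finset.card_le_univ _

theorem cappedExploration_nonneg (hτ : 0 < τ) (i : Fin n) : 0 ≤ G.cappedExploration τ i :=
  le_min (by positivity) hτ.le

theorem card_pos_of_mem (he : e ∈ G.activeResources i) : (0 : ℝ) < (G.activeResources i).card := by
  exact_mod_cast Finset.card_pos.2 ⟨e, he⟩

theorem cappedExploration_pos (hτ : 0 < τ) (he : e ∈ G.activeResources i) :
    0 < G.cappedExploration τ i :=
  lt_min (one_div_pos.2 (G.card_pos_of_mem he)) hτ

theorem card_mul_cappedExploration_le (i : Fin n) :
    (G.activeResources i).card * G.cappedExploration τ i ≤ 1 := by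
  rcases (Nat.cast_nonneg (G.activeResources i).card : (0 : ℝ) ≤ _).eq_or_lt with h | h
  · simp [← h]
  · calc _ ≤ (G.activeResources i).card * (1 / ((G.activeResources i).card : ℝ)) := by
          gcongr; exact min_le_left _ _
      _ = 1 := by field_simp

/-- The sum covers both branches of the minimum; the cap `1 / |E_i|` is the source of the summand
`Fintype.card E` in all variance bounds. -/
theorem inv_cappedExploration_le (hτ : 0 < τ) (he : e ∈ G.activeResources i) :
    1 / G.cappedExploration τ i ≤ Fintype.card E + 1 / τ := by
  have h0 := G.card_pos_of_mem he
  have h1 := G.card_activeResources_le i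
  have h2 : 0 < 1 / τ := by positivity
  unfold cappedExploration
  rcases min_choice (1 / ((G.activeResources i).card : ℝ)) τ with h | h <;> rw [h]
  · rw [one_div_one_div]; linarith
  · linarith

theorem cappedExploration_mono {τ' : ℝ} (h : τ ≤ τ') (i : Fin n) :
    G.cappedExploration τ i ≤ G.cappedExploration τ' i :=
  min_le_min_left _ h

/-- Mixing a point of the polytope with strategies that cover all active resources gives a point
that is bounded away from the boundary, at a cost proportional to the exploration parameter. -/
theorem exists_boundedAway_near (hτ : 0 < τ) {y : EuclideanSpace ℝ E} (hy : y ∈ G.polytope i) :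
    ∃ w ∈ G.boundedAwayPolytope i (G.cappedExploration τ i), ∀ g : E → ℝ,
      (∀ e, g e ∈ Set.Icc 0 G.cmax) →
      ∑ e, (w e - y e) * g e ≤ (Fintype.card E : ℝ) ^ 2 * G.cmax * τ := by
  classical
  set A := G.activeResources i
  set ν := G.cappedExploration τ i
  have hν : 0 ≤ ν := G.cappedExploration_nonneg hτ i
  have hAν : A.card * ν ≤ 1 := G.card_mul_cappedExploration_le i
  have hex : ∀ e : E, ∃ s ∈ G.strategies i, e ∈ A → e ∈ s := fun e => by
    by_cases he : e ∈ A
    · obtain ⟨s, hs, hes⟩ := Finset.mem_biUnion.1 he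
      exact ⟨s, hs, fun _ => hes⟩
    · obtain ⟨s, hs⟩ := G.strategies_nonempty i
      exact ⟨s, hs, fun h => absurd h he⟩
  choose s hs hes using hex
  -- Weight `ν` goes to one strategy covering each active resource, the rest stays on `y`. The cap
  -- on `ν` keeps the weight of `y` nonnegative.
  set w : EuclideanSpace ℝ E := (1 - A.card * ν) • y + ∑ e ∈ A, ν • indicatorVec (s e)
  have hw : ∀ e, w e = (1 - A.card * ν) * y e + ν * ∑ e' ∈ A, if e ∈ s e' then (1 : ℝ) else 0 :=
    fun e => by
      simp only [w, PiLp.add_apply, PiLp.smul_apply, WithLp.ofLp_sum, Finset.sum_apply,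
        smul_eq_mul, indicatorVec_apply, Finset.mul_sum]
  refine ⟨w, ⟨?_, fun e he => ?_⟩, fun g hg => ?_⟩
  · have := (convex_convexHull ℝ (indicatorVec '' (G.strategies i : Set (Finset E)))).sum_mem
      (t := Finset.insertNone A) (w := fun o => o.elim (1 - A.card * ν) fun _ => ν)
      (z := fun o => o.elim y fun e => indicatorVec (s e)) ?_ ?_ ?_
    · rw [Finset.sum_insertNone] at this
      exact this
    · rintro (_ | e) _
      · simpa using hAν
      · exact hν
    · simp [Finset.sum_insertNone]
    · rintro (_ | e) _
      · exact hy
      · exact subset_convexHull ℝ _ ⟨s e, hs e, rfl⟩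
  · have h1 : (1 : ℝ) ≤ ∑ e' ∈ A, if e ∈ s e' then (1 : ℝ) else 0 := by
      have h := Finset.single_le_sum (f := fun e' => if e ∈ s e' then (1 : ℝ) else 0)
        (fun _ _ => by split_ifs <;> simp) he
      simpa [hes e he] using h
    have h2 := mul_nonneg (sub_nonneg.2 hAν) (G.polytope_coord hy e).1.1
    rw [hw]
    nlinarith
  · have hm : (Fintype.card E : ℝ) ^ 2 * G.cmax * τ =
        Fintype.card E * (τ * Fintype.card E * G.cmax) := by ring
    have hA := G.card_activeResources_le i
    have hντ : ν ≤ τ := min_le_right _ _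
    have hc := G.cmax_nonneg
    rw [hm, ← nsmul_eq_mul, ← Finset.card_univ, ← Finset.sum_const]
    refine Finset.sum_le_sum fun e _ => ?_
    have h1 : ∑ e' ∈ A, (if e ∈ s e' then (1 : ℝ) else 0) ≤ A.card := by
      refine (Finset.sum_le_sum fun e' _ => ?_).trans_eq
        (by simp : ∑ e' ∈ A, (1 : ℝ) = A.card)
      split_ifs <;> simp
    -- Since `g` is nonnegative only an upper bound on `w e - y e` is needed, and the mass removed
    -- from `y` may be dropped.
    have h2 : w e - y e ≤ τ * Fintype.card E := by
      have := mul_nonneg (mul_nonneg (Nat.cast_nonneg A.card) hν) (G.polytope_coord hy e).1.1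
      have : ν * ∑ e' ∈ A, (if e ∈ s e' then (1 : ℝ) else 0) ≤ τ * Fintype.card E :=
        mul_le_mul hντ (h1.trans hA)
          (Finset.sum_nonneg fun _ _ => by split_ifs <;> simp) hτ.le
      rw [hw]; linarith
    exact (mul_le_mul_of_nonneg_right h2 (hg e).1).trans
      (mul_le_mul_of_nonneg_left (hg e).2 (by positivity))

end Exploration

/-- The joint bounded-away polytope. -/
def jointPolytope (τ : ℝ) : Set (Marginals n E) :=
  {x | ∀ i, x i ∈ G.boundedAwayPolytope i (G.cappedExploration τ i)}

theorem isCompact_jointPolytope (τ : ℝ) : IsCompact (G.jointPolytope τ) := by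
  have := isCompact_univ_pi fun i =>
    G.isCompact_boundedAwayPolytope i (G.cappedExploration τ i)
  simpa [jointPolytope, Set.pi] using this

theorem jointPolytope_anti {τ τ' : ℝ} (h : τ ≤ τ') : G.jointPolytope τ' ⊆ G.jointPolytope τ :=
  fun _ hx i => G.boundedAwayPolytope_anti i (G.cappedExploration_mono h i) (hx i)

variable {G} in
theorem inUnitCube_of_mem {τ : ℝ} {x : Marginals n E} (hx : x ∈ G.jointPolytope τ) :
    InUnitCube x := fun i e => (G.polytope_coord (hx i).1 e).1

/-! ### The Moreau envelope of the potential -/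

/-- The squared Euclidean distance. -/
def sqDist (x y : Marginals n E) : ℝ := ∑ i, ∑ e, (x i e - y i e) ^ 2

theorem sqDist_nonneg (x y : Marginals n E) : 0 ≤ sqDist x y := by unfold sqDist; positivity

/-- The Moreau envelope of the potential on the set `S`. -/
def envelope (S : Set (Marginals n E)) (L : ℝ) (z : Marginals n E) : ℝ :=
  ⨅ y : S, (G.potential y.1 + L * sqDist z y.1)

section Envelope

variable {G} {S S' : Set (Marginals n E)} {L : ℝ}

theorem envelope_summand_nonneg (hS : ∀ x ∈ S, InUnitCube x) (hL : 0 ≤ L) (z : Marginals n E)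
    (y : S) : 0 ≤ G.potential y.1 + L * sqDist z y.1 :=
  add_nonneg (G.potential_mem (hS y.1 y.2)).1 (mul_nonneg hL (sqDist_nonneg _ _))

theorem bddBelow_envelope (hS : ∀ x ∈ S, InUnitCube x) (hL : 0 ≤ L) (z : Marginals n E) :
    BddBelow (Set.range fun y : S => G.potential y.1 + L * sqDist z y.1) :=
  ⟨0, by rintro _ ⟨y, rfl⟩; exact envelope_summand_nonneg hS hL z y⟩

theorem envelope_nonneg (hS : ∀ x ∈ S, InUnitCube x) (hL : 0 ≤ L) (z : Marginals n E) :
    0 ≤ G.envelope S L z :=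
  Real.iInf_nonneg fun y => envelope_summand_nonneg hS hL z y

theorem envelope_le (hS : ∀ x ∈ S, InUnitCube x) (hL : 0 ≤ L) (z : Marginals n E)
    {y : Marginals n E} (hy : y ∈ S) : G.envelope S L z ≤ G.potential y + L * sqDist z y :=
  ciInf_le (bddBelow_envelope hS hL z) ⟨y, hy⟩

/-- As exploration decays the feasible set grows, so passing to the next round's envelope can only
lower it. This keeps the telescoping valid with a changing domain. -/
theorem envelope_anti (hS : ∀ x ∈ S', InUnitCube x) (hL : 0 ≤ L) (h : S ⊆ S') (hne : S.Nonempty)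
    (z : Marginals n E) : G.envelope S' L z ≤ G.envelope S L z := by
  have := hne.to_subtype
  exact le_ciInf fun y => envelope_le hS hL z (h y.2)

theorem envelope_le_of_mem (hS : ∀ x ∈ S, InUnitCube x) (hL : 0 ≤ L) {z : Marginals n E}
    (hz : z ∈ S) : G.envelope S L z ≤ n * Fintype.card E * G.cmax := by
  refine (envelope_le hS hL z hz).trans ?_
  simpa [sqDist] using (G.potential_mem (hS z hz)).2

theorem continuous_sqDist (y : Marginals n E) : Continuous fun z : Marginals n E => sqDist z y := by
  unfold sqDist; fun_prop

/-- An infimum of continuous functions is upper semicontinuous, hence measurable even over an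
uncountable index set. -/
theorem measurable_envelope (hS : ∀ x ∈ S, InUnitCube x) (hL : 0 ≤ L) :
    Measurable fun z : Marginals n E => G.envelope S L z := by
  refine UpperSemicontinuous.measurable ?_
  refine upperSemicontinuous_ciInf (fun z => bddBelow_envelope hS hL z) fun y => ?_
  have := continuous_sqDist y.1
  exact Continuous.upperSemicontinuous (by fun_prop)

theorem exists_eq_envelope (hS : ∀ x ∈ S, InUnitCube x) (hL : 0 ≤ L) (hc : IsCompact S)
    (hne : S.Nonempty) (z : Marginals n E) :
    ∃ y ∈ S, G.envelope S L z = G.potential y + L * sqDist z y := by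
  have hcont : Continuous fun y : Marginals n E => G.potential y + L * sqDist z y := by
    have := G.continuous_potential
    have h2 : Continuous fun y : Marginals n E => sqDist z y := by unfold sqDist; fun_prop
    fun_prop
  obtain ⟨y, hy, hmin⟩ := hc.exists_isMinOn hne hcont.continuousOn
  refine ⟨y, hy, le_antisymm (envelope_le hS hL z hy) ?_⟩
  have := hne.to_subtype
  exact le_ciInf fun w => hmin w.2

end Envelope

theorem norm_sub_le_of_isProjection {K : Set (EuclideanSpace ℝ E)} (hK : Convex ℝ K)
    {z y w : EuclideanSpace ℝ E} (hy : IsProjection K z y) (hw : w ∈ K) :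
    ‖y - w‖ ^ 2 ≤ ‖z - w‖ ^ 2 := by
  have : Nonempty K := ⟨⟨w, hw⟩⟩
  have h1 : ‖z - y‖ = ⨅ w : K, ‖z - w‖ :=
    le_antisymm (le_ciInf fun w => hy.2 w w.2)
      (ciInf_le (f := fun w : K => ‖z - w‖) ⟨0, by rintro _ ⟨w, rfl⟩; positivity⟩ ⟨y, hy.1⟩)
  -- The angle at the projection is obtuse, so the cross term in the expansion below has the
  -- favourable sign.
  have h2 := (norm_eq_iInf_iff_real_inner_le_zero hK hy.1).1 h1 w hw
  have h3 : z - w = (z - y) - (w - y) := by abel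
  have h4 := norm_sub_sq_real (z - y) (w - y)
  rw [h3, h4, norm_sub_rev y w]
  nlinarith [sq_nonneg ‖z - y‖]

/-- Projecting does not increase the envelope. -/
theorem envelope_projection_le {τ L : ℝ} (hL : 0 ≤ L) {z y : Marginals n E}
    (hy : ∀ i, IsProjection (G.boundedAwayPolytope i (G.cappedExploration τ i)) (z i) (y i)) :
    G.envelope (G.jointPolytope τ) L y ≤ G.envelope (G.jointPolytope τ) L z := by
  have : Nonempty (G.jointPolytope τ) := ⟨⟨y, fun i => (hy i).1⟩⟩
  refine le_ciInf fun w =>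
    (envelope_le (fun _ => inUnitCube_of_mem) hL y w.2).trans ?_
  have : sqDist y w.1 ≤ sqDist z w.1 := by
    refine Finset.sum_le_sum fun i _ => ?_
    have := norm_sub_le_of_isProjection (G.convex_boundedAwayPolytope i _) (hy i) (w.2 i)
    simpa [EuclideanSpace.real_norm_sq_eq] using this
  have := mul_le_mul_of_nonneg_left this hL
  linarith

end CongestionGame

theorem Finset.sum_mul_le_mul_of_sq_le {ι : Type*} (s : Finset ι) {f g : ι → ℝ} {a b : ℝ}
    (ha : 0 ≤ a) (hb : 0 ≤ b) (hf : ∑ i ∈ s, f i ^ 2 ≤ a ^ 2) (hg : ∑ i ∈ s, g i ^ 2 ≤ b ^ 2) :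
    ∑ i ∈ s, f i * g i ≤ a * b :=
  (Real.sum_mul_le_sqrt_mul_sqrt s f g).trans
    (mul_le_mul ((Real.sqrt_le_left ha).2 hf) ((Real.sqrt_le_left hb).2 hg) (Real.sqrt_nonneg _) ha)

/-! ### First-order optimality at the minimizer of the envelope. -/

namespace CongestionGame

variable {n : ℕ} {E : Type u} [Fintype E] [DecidableEq E] (G : CongestionGame n E)

/-- The variational inequality, agent by agent, at a point that attains the envelope. -/
theorem envelope_variational {τ L : ℝ} (hL : 0 ≤ L) {x y : Marginals n E}
    (hy : y ∈ G.jointPolytope τ)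
    (hmin : G.envelope (G.jointPolytope τ) L x = G.potential y + L * sqDist x y) (i : Fin n)
    {w : EuclideanSpace ℝ E} (hw : w ∈ G.boundedAwayPolytope i (G.cappedExploration τ i)) :
    2 * L * ∑ e, (x i e - y i e) * (w e - y i e) ≤ ∑ e, (w e - y i e) * G.marginalCost y i e := by
  set B := ∑ e, (w e - y i e) * G.marginalCost y i e
  set D := ∑ e, (x i e - y i e) * (w e - y i e)
  set Q := ∑ e, (w e - y i e) ^ 2
  -- Only agent `i` moves, from `y i` towards `w`. The potential is affine in her block, so the sole
  -- second-order term comes from the squared distance; the claim follows as `t` tends to 0.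
  have key : ∀ t : ℝ, 0 < t → t ≤ 1 → 0 ≤ (B - 2 * L * D) + t * (L * Q) := by
    intro t ht0 ht1
    set v : EuclideanSpace ℝ E := y i + t • (w - y i)
    have hv : v ∈ G.boundedAwayPolytope i (G.cappedExploration τ i) := by
      have := G.convex_boundedAwayPolytope i (G.cappedExploration τ i)
      exact this.add_smul_sub_mem (hy i) hw ⟨ht0.le, ht1⟩
    have hve : ∀ e, v e = y i e + t * (w e - y i e) := fun e => by simp [v]
    have hmem : Function.update y i v ∈ G.jointPolytope τ := by
      intro j
      rcases eq_or_ne j i with rfl | h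
      · simpa using hv
      · simpa [h] using hy j
    have h1 := envelope_le (G := G) (fun _ => inUnitCube_of_mem) hL x hmem
    have h2 : sqDist x (Function.update y i v) = sqDist x y - 2 * t * D + t ^ 2 * Q := by
      unfold sqDist
      rw [← Finset.add_sum_erase _ _ (Finset.mem_univ i),
        ← Finset.add_sum_erase Finset.univ (fun i => ∑ e, (x i e - y i e) ^ 2) (Finset.mem_univ i)]
      have h3 : ∑ j ∈ Finset.univ.erase i, ∑ e, (x j e - Function.update y i v j e) ^ 2 =
          ∑ j ∈ Finset.univ.erase i, ∑ e, (x j e - y j e) ^ 2 :=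
        Finset.sum_congr rfl fun j hj => by
          rw [Function.update_of_ne (Finset.ne_of_mem_erase hj)]
      have h4 : ∑ e, (x i e - v e) ^ 2 =
          ∑ e, (x i e - y i e) ^ 2 - 2 * t * D + t ^ 2 * Q := by
        simp only [D, Q, Finset.mul_sum, ← Finset.sum_sub_distrib, ← Finset.sum_add_distrib, hve]
        exact Finset.sum_congr rfl fun e _ => by ring
      rw [h3, Function.update_self, h4]; ring
    have h5 : ∑ e, (v e - y i e) * G.marginalCost y i e = t * B := by
      simp only [B, Finset.mul_sum, hve]
      exact Finset.sum_congr rfl fun e _ => by ring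
    rw [hmin, G.potential_update, h5, h2] at h1
    have h6 : 0 ≤ t * ((B - 2 * L * D) + t * (L * Q)) := by nlinarith
    exact nonneg_of_mul_nonneg_right h6 ht0
  by_contra! hlt
  have hQ : 0 ≤ L * Q := mul_nonneg hL (Finset.sum_nonneg fun _ _ => sq_nonneg _)
  set a := 2 * L * D - B
  have ha : 0 < a := by simp only [a]; linarith
  -- This `t` makes the quadratic term at most `a / 2`; the `+ 1` guards against `L * Q = 0`.
  have h1 := key (min 1 (a / (2 * (L * Q + 1)))) (by positivity) (min_le_left _ _)
  have h2 : min 1 (a / (2 * (L * Q + 1))) * (L * Q) ≤ a / 2 := by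
    calc _ ≤ a / (2 * (L * Q + 1)) * (L * Q) := by gcongr; exact min_le_right _ _
      _ = a / 2 * (L * Q / (L * Q + 1)) := by field_simp
      _ ≤ a / 2 * 1 := by
          gcongr; rw [div_le_one (by positivity)]; linarith
      _ = _ := by ring
  have : B - 2 * L * D = -a := by simp only [a]; ring
  linarith

/-- The marginal costs are Lipschitz with constant `n * cmax`. -/
theorem sum_marginalCost_sub_sq_le {x y : Marginals n E} (hx : InUnitCube x) (hy : InUnitCube y)
    (i : Fin n) :
    ∑ e, (G.marginalCost x i e - G.marginalCost y i e) ^ 2 ≤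
      G.cmax ^ 2 * (n * sqDist x y) := by
  have h : ∀ e, (G.marginalCost x i e - G.marginalCost y i e) ^ 2 ≤
      G.cmax ^ 2 * (n * ∑ j, (x j e - y j e) ^ 2) := fun e => by
    have h1 := G.abs_marginalCost_sub_le hx hy i e
    have h2 := sq_sum_le_card_mul_sum_sq (s := Finset.univ) (f := fun j => |x j e - y j e|)
    simp only [sq_abs, Finset.card_univ, Fintype.card_fin] at h2
    calc _ = |G.marginalCost x i e - G.marginalCost y i e| ^ 2 := (sq_abs _).symm
      _ ≤ (G.cmax * ∑ j, |x j e - y j e|) ^ 2 := by gcongr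
      _ = G.cmax ^ 2 * (∑ j, |x j e - y j e|) ^ 2 := by ring
      _ ≤ _ := by gcongr
  refine (Finset.sum_le_sum fun e _ => h e).trans_eq ?_
  rw [← Finset.mul_sum, ← Finset.mul_sum, sqDist, Finset.sum_comm]

/-- Weak convexity of the potential, and the reason for `L = n * cmax`: on one resource the marginal
costs change by at most `cmax` times the ℓ¹ change of the marginals, and Cauchy–Schwarz over the
agents costs a factor `n`. -/
theorem neg_sqDist_le_sum_marginalCost {x y : Marginals n E} (hx : InUnitCube x)
    (hy : InUnitCube y) :
    -(n * G.cmax * sqDist x y) ≤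
      ∑ i, ∑ e, (x i e - y i e) * (G.marginalCost x i e - G.marginalCost y i e) := by
  have h : ∀ e, -(n * G.cmax * ∑ i, (x i e - y i e) ^ 2) ≤
      ∑ i, (x i e - y i e) * (G.marginalCost x i e - G.marginalCost y i e) := fun e => by
    have h2 := sq_sum_le_card_mul_sum_sq (s := Finset.univ) (f := fun j => |x j e - y j e|)
    simp only [sq_abs, Finset.card_univ, Fintype.card_fin] at h2
    have h3 : ∑ i, -(|x i e - y i e| * (G.cmax * ∑ j, |x j e - y j e|)) ≤
        ∑ i, (x i e - y i e) * (G.marginalCost x i e - G.marginalCost y i e) := by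
      refine Finset.sum_le_sum fun i _ => ?_
      refine le_trans ?_ (neg_abs_le _)
      rw [abs_mul, neg_le_neg_iff]
      exact mul_le_mul_of_nonneg_left (G.abs_marginalCost_sub_le hx hy i e) (abs_nonneg _)
    refine le_trans ?_ h3
    rw [Finset.sum_neg_distrib, ← Finset.sum_mul, neg_le_neg_iff]
    have := mul_le_mul_of_nonneg_left h2 G.cmax_nonneg
    nlinarith
  rw [Finset.sum_comm]
  refine le_trans (le_of_eq ?_) (Finset.sum_le_sum fun e _ => h e)
  rw [Finset.sum_neg_distrib, ← Finset.mul_sum, sqDist, Finset.sum_comm]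

/-- The gradient of the potential is aligned with the direction to the point that attains the
envelope. -/
theorem envelope_descent {τ : ℝ} {x y : Marginals n E} (hx : x ∈ G.jointPolytope τ)
    (hy : y ∈ G.jointPolytope τ)
    (hmin : G.envelope (G.jointPolytope τ) (n * G.cmax) x =
      G.potential y + n * G.cmax * sqDist x y) :
    n * G.cmax * sqDist x y ≤ ∑ i, ∑ e, (x i e - y i e) * G.marginalCost x i e := by
  have hL : 0 ≤ n * G.cmax := mul_nonneg (Nat.cast_nonneg _) G.cmax_nonneg
  -- Testing optimality with `w = x i` gives `2 * L * sqDist x y` at the gradient in `y`; moving the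
  -- gradient to `x` gives back half of it by weak convexity.
  have h1 := Finset.sum_le_sum fun i (_ : i ∈ Finset.univ) =>
    G.envelope_variational hL hy hmin i (hx i)
  have h2 := G.neg_sqDist_le_sum_marginalCost (inUnitCube_of_mem hx) (inUnitCube_of_mem hy)
  rw [← Finset.mul_sum] at h1
  have h3 : ∑ i, ∑ e, (x i e - y i e) * (x i e - y i e) = sqDist x y := by
    simp only [sqDist, sq]
  rw [h3] at h1
  simp only [mul_sub, Finset.sum_sub_distrib] at h2
  linarith

/-! ### One round: unbiased estimates, expected envelope decrease and exploitability. -/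

/-- The marginals of a mixed profile. -/
def IsMarginal (π : G.MixedProfile) (x : Marginals n E) : Prop :=
  (∀ i, π i ∈ stdSimplex ℝ (G.Strategy i)) ∧ ∀ i e, x i e = G.marginal (π i) e

/-- The point reached by an unprojected gradient step. -/
def gradientStep (γ : ℝ) (x : Marginals n E) (q : G.Profile) : Marginals n E :=
  fun i => x i - γ • G.costEstimate i (x i) q

theorem costEstimate_apply (i : Fin n) (x : EuclideanSpace ℝ E) (q : G.Profile) (e : E) :
    G.costEstimate i x q e = if e ∈ (q i).1 then G.cost e (G.load q e) / x e else 0 := rfl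

theorem gradientStep_apply (γ : ℝ) (x : Marginals n E) (q : G.Profile) (i : Fin n) (e : E) :
    G.gradientStep γ x q i e = x i e - γ * G.costEstimate i (x i) q e := rfl

section Step

variable {G} {π : G.MixedProfile} {x : Marginals n E} {τ : ℝ}

theorem IsMarginal.sum_eq_one (h : G.IsMarginal π x) (i : Fin n) : ∑ s, π i s = 1 := (h.1 i).2

theorem IsMarginal.prod_nonneg (h : G.IsMarginal π x) (q : G.Profile) : 0 ≤ ∏ j, π j (q j) :=
  Finset.prod_nonneg fun j _ => (h.1 j).1 _

theorem IsMarginal.sum_prod (h : G.IsMarginal π x) : ∑ q : G.Profile, ∏ j, π j (q j) = 1 := by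
  rw [← Fintype.piFinset_univ, ← Finset.prod_univ_sum]
  exact Finset.prod_eq_one fun i _ => h.sum_eq_one i

theorem pos_of_mem_jointPolytope (hτ : 0 < τ) (hx : x ∈ G.jointPolytope τ) {i : Fin n} {e : E}
    (he : e ∈ G.activeResources i) : 0 < x i e :=
  (G.cappedExploration_pos hτ he).trans_le ((hx i).2 e he)

theorem one_div_le_of_mem_jointPolytope (hτ : 0 < τ) (hx : x ∈ G.jointPolytope τ) {i : Fin n}
    {e : E} (he : e ∈ G.activeResources i) : 1 / x i e ≤ Fintype.card E + 1 / τ :=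
  (one_div_le_one_div_of_le (G.cappedExploration_pos hτ he) ((hx i).2 e he)).trans
    (G.inv_cappedExploration_le hτ he)

/-- The cost estimates are unbiased. -/
theorem sum_costEstimate (h : G.IsMarginal π x) (hτ : 0 < τ) (hx : x ∈ G.jointPolytope τ)
    {i : Fin n} {e : E} (he : e ∈ G.activeResources i) :
    ∑ q : G.Profile, (∏ j, π j (q j)) * G.costEstimate i (x i) q e = G.marginalCost x i e := by
  have h0 := pos_of_mem_jointPolytope hτ hx he
  have h1 := G.sum_profile_cost h.sum_eq_one i e h.2
  rw [← mul_right_inj' h0.ne', ← h1, Finset.mul_sum]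
  refine Finset.sum_congr rfl fun q _ => ?_
  rw [costEstimate_apply]
  split_ifs
  · field_simp
  · simp

theorem costEstimate_of_notMem {i : Fin n} {e : E} (he : e ∉ G.activeResources i) (q : G.Profile) :
    G.costEstimate i (x i) q e = 0 := by
  rw [costEstimate_apply, if_neg fun h => he (G.mem_activeResources (q i).2 h)]

/-- The second moments of the cost estimates. -/
theorem sum_costEstimate_sq_le (h : G.IsMarginal π x) (hτ : 0 < τ) (hx : x ∈ G.jointPolytope τ)
    (i : Fin n) (e : E) :
    ∑ q : G.Profile, (∏ j, π j (q j)) * G.costEstimate i (x i) q e ^ 2 ≤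
      G.cmax ^ 2 * (Fintype.card E + 1 / τ) := by
  have hc := G.cmax_nonneg
  by_cases he : e ∈ G.activeResources i
  · have h0 := pos_of_mem_jointPolytope hτ hx he
    have h1 := one_div_le_of_mem_jointPolytope hτ hx he
    have h2 := (G.marginalCost_mem (inUnitCube_of_mem hx) i e).2
    -- Only one of the two factors is bounded by `cmax / x i e`; the other averages to the marginal
    -- cost. The variance thus grows like `1 / x i e`, not its square.
    calc _ ≤ ∑ q : G.Profile, (∏ j, π j (q j)) * G.costEstimate i (x i) q e *
          (G.cmax * (1 / x i e)) := by
          refine Finset.sum_le_sum fun q _ => ?_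
          rw [sq, mul_assoc]
          refine mul_le_mul_of_nonneg_left ?_ (h.prod_nonneg q)
          rw [costEstimate_apply]
          split_ifs
          · have hl : G.cost e (G.load q e) ≤ G.cmax := (G.cost_card_mem e (G.users q e)).2
            have := G.cost_nonneg e (G.load q e)
            rw [mul_one_div]
            gcongr
          · simp
      _ = G.marginalCost x i e * (G.cmax * (1 / x i e)) := by
          rw [← Finset.sum_mul, sum_costEstimate h hτ hx he]
      _ ≤ G.cmax * (G.cmax * (Fintype.card E + 1 / τ)) := by gcongr
      _ = _ := by ring
  · simp only [costEstimate_of_notMem he]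
    simpa using by positivity

/-- The expected distance after a gradient step. -/
theorem sum_sqDist_gradientStep_le (h : G.IsMarginal π x) (hτ : 0 < τ)
    (hx : x ∈ G.jointPolytope τ) {y : Marginals n E} (hy : y ∈ G.jointPolytope τ) (γ : ℝ) :
    ∑ q : G.Profile, (∏ j, π j (q j)) * sqDist (G.gradientStep γ x q) y ≤
      sqDist x y - 2 * γ * ∑ i, ∑ e, (x i e - y i e) * G.marginalCost x i e +
        γ ^ 2 * (n * Fintype.card E * (G.cmax ^ 2 * (Fintype.card E + 1 / τ))) := by
  have key : ∀ i e, ∑ q : G.Profile,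
      (∏ j, π j (q j)) * (G.gradientStep γ x q i e - y i e) ^ 2 ≤
      (x i e - y i e) ^ 2 - 2 * γ * ((x i e - y i e) * G.marginalCost x i e) +
        γ ^ 2 * (G.cmax ^ 2 * (Fintype.card E + 1 / τ)) := by
    intro i e
    have h1 : (x i e - y i e) * ∑ q : G.Profile, (∏ j, π j (q j)) * G.costEstimate i (x i) q e =
        (x i e - y i e) * G.marginalCost x i e := by
      -- The estimate need not be unbiased at a resource the agent can never use, but there `x` and
      -- `y` both vanish.
      by_cases he : e ∈ G.activeResources i
      · rw [sum_costEstimate h hτ hx he]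
      · rw [(G.polytope_coord (hx i).1 e).2 he, (G.polytope_coord (hy i).1 e).2 he]; simp
    have h2 := mul_le_mul_of_nonneg_left (sum_costEstimate_sq_le h hτ hx i e) (sq_nonneg γ)
    have h3 : ∑ q : G.Profile, (∏ j, π j (q j)) * (G.gradientStep γ x q i e - y i e) ^ 2 =
        (∑ q : G.Profile, ∏ j, π j (q j)) * (x i e - y i e) ^ 2 -
        2 * γ * ((x i e - y i e) * ∑ q : G.Profile, (∏ j, π j (q j)) *
          G.costEstimate i (x i) q e) +
        γ ^ 2 * ∑ q : G.Profile, (∏ j, π j (q j)) * G.costEstimate i (x i) q e ^ 2 := by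
      simp only [Finset.mul_sum, Finset.sum_mul, ← Finset.sum_sub_distrib,
        ← Finset.sum_add_distrib, gradientStep_apply]
      exact Finset.sum_congr rfl fun q _ => by ring
    rw [h3, h.sum_prod, h1]
    linarith
  have h1 : ∑ q : G.Profile, (∏ j, π j (q j)) * sqDist (G.gradientStep γ x q) y =
      ∑ i, ∑ e, ∑ q : G.Profile, (∏ j, π j (q j)) * (G.gradientStep γ x q i e - y i e) ^ 2 := by
    simp only [sqDist, Finset.mul_sum]
    rw [Finset.sum_comm]
    exact Finset.sum_congr rfl fun i _ => Finset.sum_comm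
  rw [h1]
  refine (Finset.sum_le_sum fun i _ => Finset.sum_le_sum fun e _ => key i e).trans_eq ?_
  simp only [Finset.sum_add_distrib, Finset.sum_sub_distrib, ← Finset.mul_sum, sqDist,
    Finset.sum_const, Finset.card_univ, Fintype.card_fin, nsmul_eq_mul]
  ring

/-- The expected decrease of the envelope in one gradient step. -/
theorem sum_envelope_gradientStep_le (h : G.IsMarginal π x) (hτ : 0 < τ)
    (hx : x ∈ G.jointPolytope τ) {y : Marginals n E} (hy : y ∈ G.jointPolytope τ)
    (hmin : G.envelope (G.jointPolytope τ) (n * G.cmax) x =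
      G.potential y + n * G.cmax * sqDist x y) {γ : ℝ} (hγ : 0 ≤ γ) :
    ∑ q : G.Profile, (∏ j, π j (q j)) *
        G.envelope (G.jointPolytope τ) (n * G.cmax) (G.gradientStep γ x q) ≤
      G.envelope (G.jointPolytope τ) (n * G.cmax) x -
        2 * γ * ((n * G.cmax) ^ 2 * sqDist x y) +
        γ ^ 2 * (n * G.cmax * (n * Fintype.card E * (G.cmax ^ 2 * (Fintype.card E + 1 / τ)))) := by
  have hL : 0 ≤ n * G.cmax := mul_nonneg (Nat.cast_nonneg _) G.cmax_nonneg
  have h1 : ∑ q : G.Profile, (∏ j, π j (q j)) *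
        G.envelope (G.jointPolytope τ) (n * G.cmax) (G.gradientStep γ x q) ≤
      ∑ q : G.Profile, (∏ j, π j (q j)) *
        (G.potential y + n * G.cmax * sqDist (G.gradientStep γ x q) y) :=
    Finset.sum_le_sum fun q _ => mul_le_mul_of_nonneg_left
      (envelope_le (fun _ => inUnitCube_of_mem) hL _ hy) (h.prod_nonneg q)
  refine h1.trans ?_
  have h2 : ∑ q : G.Profile, (∏ j, π j (q j)) *
        (G.potential y + n * G.cmax * sqDist (G.gradientStep γ x q) y) =
      (∑ q : G.Profile, ∏ j, π j (q j)) * G.potential y + n * G.cmax *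
        ∑ q : G.Profile, (∏ j, π j (q j)) * sqDist (G.gradientStep γ x q) y := by
    simp only [Finset.mul_sum, Finset.sum_mul, ← Finset.sum_add_distrib]
    exact Finset.sum_congr rfl fun q _ => by ring
  have h3 := mul_le_mul_of_nonneg_left (sum_sqDist_gradientStep_le h hτ hx hy γ) hL
  have h4 := mul_le_mul_of_nonneg_left (G.envelope_descent hx hy hmin)
    (mul_nonneg (mul_nonneg zero_le_two hγ) hL)
  rw [h2, h.sum_prod, hmin]
  linarith

/-- The gain from a deviation, in terms of the distance to the point that attains the envelope. -/
theorem deviation_gain_le (hτ : 0 < τ) (hx : x ∈ G.jointPolytope τ) {y : Marginals n E}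
    (hy : y ∈ G.jointPolytope τ)
    (hmin : G.envelope (G.jointPolytope τ) (n * G.cmax) x =
      G.potential y + n * G.cmax * sqDist x y) (i : Fin n) {v : EuclideanSpace ℝ E}
    (hv : v ∈ G.polytope i) :
    ∑ e, (x i e - v e) * G.marginalCost x i e ≤
      4 * (n * G.cmax) * √(Fintype.card E) * √(sqDist x y) +
        (Fintype.card E : ℝ) ^ 2 * G.cmax * τ := by
  obtain ⟨w, hw, hwv⟩ := G.exists_boundedAway_near hτ hv
  have hc := G.cmax_nonneg
  have hL : 0 ≤ n * G.cmax := mul_nonneg (Nat.cast_nonneg _) hc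
  have hxc := inUnitCube_of_mem hx
  have hyc := inUnitCube_of_mem hy
  have hn : (1 : ℝ) ≤ n := by exact_mod_cast (Fin.pos i)
  set d := √(sqDist x y)
  set M := √(Fintype.card E : ℝ)
  have hd : d ^ 2 = sqDist x y := Real.sq_sqrt (sqDist_nonneg x y)
  have hM : M ^ 2 = Fintype.card E := Real.sq_sqrt (by positivity)
  have hd0 : 0 ≤ d := Real.sqrt_nonneg _
  have hM0 : 0 ≤ M := Real.sqrt_nonneg _
  have hxy : ∑ e, (x i e - y i e) ^ 2 ≤ d ^ 2 := by
    rw [hd]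
    exact Finset.single_le_sum (f := fun i => ∑ e, (x i e - y i e) ^ 2)
      (fun _ _ => by positivity) (Finset.mem_univ i)
  have hyw : ∑ e, (y i e - w e) ^ 2 ≤ M ^ 2 := by
    have h1 : ∀ e, (y i e - w e) ^ 2 ≤ 1 := fun e => by
      have h1 := hyc i e
      have h2 := (G.polytope_coord hw.1 e).1
      rw [sq_le_one_iff_abs_le_one, abs_le]
      constructor <;> linarith [h1.1, h1.2, h2.1, h2.2]
    refine (Finset.sum_le_sum fun e _ => h1 e).trans_eq ?_
    simp [hM]
  have hg : ∑ e, G.marginalCost x i e ^ 2 ≤ (G.cmax * M) ^ 2 := by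
    have h1 : ∀ e, G.marginalCost x i e ^ 2 ≤ G.cmax ^ 2 := fun e => by
      have := G.marginalCost_mem hxc i e
      exact pow_le_pow_left₀ this.1 this.2 2
    refine (Finset.sum_le_sum fun e _ => h1 e).trans_eq ?_
    rw [mul_pow, hM]; simp; ring
  have hgg : ∑ e, (G.marginalCost x i e - G.marginalCost y i e) ^ 2 ≤ (n * G.cmax * d) ^ 2 := by
    refine (G.sum_marginalCost_sub_sq_le hxc hyc i).trans ?_
    rw [← hd]
    have : (n : ℝ) ≤ n ^ 2 := by nlinarith
    calc G.cmax ^ 2 * (n * d ^ 2) ≤ G.cmax ^ 2 * ((n : ℝ) ^ 2 * d ^ 2) := by gcongr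
      _ = _ := by ring
  have t1 : ∑ e, (y i e - w e) * G.marginalCost y i e ≤ 2 * (n * G.cmax) * (d * M) := by
    have h1 := G.envelope_variational hL hy hmin i hw
    have h2 := mul_le_mul_of_nonneg_left
      (Finset.univ.sum_mul_le_mul_of_sq_le hd0 hM0 hxy hyw) (mul_nonneg zero_le_two hL)
    have h3 : ∑ e, (y i e - w e) * G.marginalCost y i e =
        -∑ e, (w e - y i e) * G.marginalCost y i e := by
      rw [← Finset.sum_neg_distrib]; exact Finset.sum_congr rfl fun e _ => by ring
    have h4 : ∑ e, (x i e - y i e) * (y i e - w e) =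
        -∑ e, (x i e - y i e) * (w e - y i e) := by
      rw [← Finset.sum_neg_distrib]; exact Finset.sum_congr rfl fun e _ => by ring
    rw [h4] at h2
    linarith
  have t2 := Finset.univ.sum_mul_le_mul_of_sq_le hd0 (mul_nonneg hc hM0) hxy hg
  have t3 := Finset.univ.sum_mul_le_mul_of_sq_le hM0 (mul_nonneg hL hd0) hyw hgg
  have t4 := hwv (fun e => G.marginalCost x i e) fun e => G.marginalCost_mem hxc i e
  -- The path from `x` to `v` passes through `y` and the explorable point `w`: optimality of `y`
  -- pays for the first term, closeness of `x` and `y` for the next two, exploration for the last.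
  -- The coefficients 2, 1, 1 add up to 4, using `cmax ≤ n * cmax`.
  have e1 : ∑ e, (x i e - v e) * G.marginalCost x i e =
      ∑ e, (y i e - w e) * G.marginalCost y i e + ∑ e, (x i e - y i e) * G.marginalCost x i e +
      ∑ e, (y i e - w e) * (G.marginalCost x i e - G.marginalCost y i e) +
      ∑ e, (w e - v e) * G.marginalCost x i e := by
    simp only [← Finset.sum_add_distrib]
    exact Finset.sum_congr rfl fun e _ => by ring
  have t5 : G.cmax * (M * d) ≤ n * (G.cmax * (M * d)) :=
    le_mul_of_one_le_left (by positivity) hn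
  rw [e1]
  linarith

theorem isMarginal_update (h : G.IsMarginal π x) (i : Fin n) {σ : G.Strategy i → ℝ}
    (hσ : σ ∈ stdSimplex ℝ (G.Strategy i)) :
    G.IsMarginal (Function.update π i σ) (Function.update x i (G.marginal σ)) := by
  constructor
  · intro j
    rcases eq_or_ne j i with rfl | hj
    · simpa using hσ
    · simpa [hj] using h.1 j
  · intro j
    rcases eq_or_ne j i with rfl | hj
    · simp
    · simpa [hj] using h.2 j

theorem expectedCost_update (h : G.IsMarginal π x) (i : Fin n) {σ : G.Strategy i → ℝ}
    (hσ : σ ∈ stdSimplex ℝ (G.Strategy i)) :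
    G.expectedCost i (Function.update π i σ) =
      ∑ e, G.marginal σ e * G.marginalCost x i e := by
  have h' := isMarginal_update h i hσ
  rw [G.expectedCost_eq h'.sum_eq_one i h'.2]
  simp [marginalCost_update]

theorem nonempty_stdSimplex (i : Fin n) : Nonempty (stdSimplex ℝ (G.Strategy i)) := by
  obtain ⟨s, hs⟩ := G.strategies_nonempty i
  exact ⟨⟨_, single_mem_stdSimplex ℝ (⟨s, hs⟩ : G.Strategy i)⟩⟩

/-- An agent's expected cost is linear in her own marginals, with coefficients independent of them,
so deviations need only be tested at points of her polytope. -/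
theorem exploitability_le (h : G.IsMarginal π x) {B : ℝ} (hB : 0 ≤ B)
    (hdev : ∀ i, ∀ v ∈ G.polytope i, ∑ e, (x i e - v e) * G.marginalCost x i e ≤ B) :
    G.exploitability π ≤ B := by
  refine Real.iSup_le (fun i => ?_) hB
  have := nonempty_stdSimplex (G := G) i
  rw [sub_le_comm]
  refine le_ciInf fun σ => ?_
  have h1 := hdev i _ (G.marginal_mem_polytope σ.2)
  rw [expectedCost_update h i σ.2, G.expectedCost_eq h.sum_eq_one i h.2]
  simp only [sub_mul, Finset.sum_sub_distrib] at h1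
  linarith

theorem IsMarginal.mem_polytope (h : G.IsMarginal π x) (i : Fin n) : x i ∈ G.polytope i := by
  have : x i = G.marginal (π i) := by ext e; exact h.2 i e
  rw [this]; exact G.marginal_mem_polytope (h.1 i)

theorem IsMarginal.inUnitCube (h : G.IsMarginal π x) : InUnitCube x :=
  fun i e => (G.polytope_coord (h.mem_polytope i) e).1

theorem exploitability_le_card_mul_cmax (h : G.IsMarginal π x) :
    G.exploitability π ≤ Fintype.card E * G.cmax := by
  have hc := G.cmax_nonneg
  refine exploitability_le h (by positivity) fun i v hv => ?_
  rw [← nsmul_eq_mul, ← Finset.card_univ, ← Finset.sum_const]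
  refine Finset.sum_le_sum fun e _ => ?_
  have h1 := G.marginalCost_mem h.inUnitCube i e
  have h2 := h.inUnitCube i e
  have h3 := (G.polytope_coord hv e).1
  have h4 : x i e - v e ≤ 1 := by linarith [h2.2, h3.1]
  calc _ ≤ 1 * G.marginalCost x i e := mul_le_mul_of_nonneg_right h4 h1.1
    _ ≤ _ := by linarith [h1.2]

theorem expectedCost_update_nonneg (h : G.IsMarginal π x) (i : Fin n) {σ : G.Strategy i → ℝ}
    (hσ : σ ∈ stdSimplex ℝ (G.Strategy i)) :
    0 ≤ G.expectedCost i (Function.update π i σ) := by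
  rw [expectedCost_update h i hσ]
  exact Finset.sum_nonneg fun e _ =>
    mul_nonneg (G.polytope_coord (G.marginal_mem_polytope hσ) e).1.1
      (G.marginalCost_mem h.inUnitCube i e).1

theorem exploitability_nonneg (h : G.IsMarginal π x) : 0 ≤ G.exploitability π := by
  refine Real.iSup_nonneg fun i => sub_nonneg.2 ?_
  refine (ciInf_le ?_ ⟨π i, h.1 i⟩).trans_eq ?_
  · exact ⟨0, by rintro _ ⟨σ, rfl⟩; exact expectedCost_update_nonneg h i σ.2⟩
  · simp

/-- The exploitability is controlled by the expected decrease of the envelope in the next step. -/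
theorem exploitability_le_envelope_decrease (h : G.IsMarginal π x) (hτ : 0 < τ)
    (hx : x ∈ G.jointPolytope τ) {γ η : ℝ} (hγ : 0 < γ) (hη : 0 < η) :
    G.exploitability π ≤ 1 / (4 * η) + (Fintype.card E : ℝ) ^ 2 * G.cmax * τ +
      8 * Fintype.card E * η *
      ((G.envelope (G.jointPolytope τ) (n * G.cmax) x - ∑ q : G.Profile, (∏ j, π j (q j)) *
        G.envelope (G.jointPolytope τ) (n * G.cmax) (G.gradientStep γ x q)) / γ +
      γ * (n * G.cmax * (n * Fintype.card E * (G.cmax ^ 2 * (Fintype.card E + 1 / τ))))) := by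
  have hc := G.cmax_nonneg
  have hL : 0 ≤ n * G.cmax := mul_nonneg (Nat.cast_nonneg _) hc
  obtain ⟨y, hy, hmin⟩ := exists_eq_envelope (G := G) (L := n * G.cmax) (S := G.jointPolytope τ)
    (fun _ => inUnitCube_of_mem) hL (G.isCompact_jointPolytope τ) ⟨x, hx⟩ x
  have h1 := sum_envelope_gradientStep_le h hτ hx hy hmin hγ.le
  have h2 : G.exploitability π ≤ 4 * (n * G.cmax) * √(Fintype.card E) * √(sqDist x y) +
        (Fintype.card E : ℝ) ^ 2 * G.cmax * τ :=
    exploitability_le h (by positivity) fun i v hv => deviation_gain_le hτ hx hy hmin i hv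
  set R := n * G.cmax * (n * Fintype.card E * (G.cmax ^ 2 * (Fintype.card E + 1 / τ)))
  set W := G.envelope (G.jointPolytope τ) (n * G.cmax) x - ∑ q : G.Profile, (∏ j, π j (q j)) *
        G.envelope (G.jointPolytope τ) (n * G.cmax) (G.gradientStep γ x q) with hW
  have h3 : 2 * ((n * G.cmax) ^ 2 * sqDist x y) ≤ W / γ + γ * R := by
    have h4 : γ * (2 * ((n * G.cmax) ^ 2 * sqDist x y)) ≤ W + γ ^ 2 * R := by
      rw [hW]; linarith
    have h5 : W / γ + γ * R = (W + γ ^ 2 * R) / γ := by field_simp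
    rw [h5, le_div_iff₀ hγ]; linarith
  set A := 4 * (n * G.cmax) * √(Fintype.card E) * √(sqDist x y)
  have hA : A ^ 2 = 8 * Fintype.card E * (2 * ((n * G.cmax) ^ 2 * sqDist x y)) := by
    simp only [A, mul_pow]
    rw [Real.sq_sqrt (by positivity), Real.sq_sqrt (sqDist_nonneg x y)]; ring
  have h6 : A ≤ 1 / (4 * η) + η * A ^ 2 := by
    have : 1 / (4 * η) + η * A ^ 2 - A = (2 * η * A - 1) ^ 2 / (4 * η) := by field_simp; ring
    have : 0 ≤ (2 * η * A - 1) ^ 2 / (4 * η) := by positivity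
    linarith
  have h7 := mul_le_mul_of_nonneg_left h3
    (by positivity : (0 : ℝ) ≤ 8 * Fintype.card E * η)
  have h8 : η * A ^ 2 = 8 * Fintype.card E * η * (2 * ((n * G.cmax) ^ 2 * sqDist x y)) := by
    rw [hA]; ring
  linarith

end Step

end CongestionGame

/-! ### Telescoping with decreasing step sizes, and integrals of affine expressions. -/

/-- Weighted telescoping: the decreases of a bounded quantity, weighted by increasing factors. -/
theorem Finset.sum_Icc_sub_div_le {a b γ : ℕ → ℝ} {Δ : ℝ} {T : ℕ} (hT : 1 ≤ T)
    (hγ : ∀ t, 1 ≤ t → 0 < γ t) (hanti : ∀ t, 1 ≤ t → γ (t + 1) ≤ γ t)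
    (ha : ∀ t, 1 ≤ t → t ≤ T → a t ≤ Δ) (hab : ∀ t, 1 ≤ t → t < T → a (t + 1) ≤ b t)
    (hb : 0 ≤ b T) : ∑ t ∈ Finset.Icc 1 T, (a t - b t) / γ t ≤ Δ / γ T := by
  have key : ∀ k, 1 ≤ k → k ≤ T →
      ∑ t ∈ Finset.Icc 1 k, (a t - b t) / γ t ≤ (Δ - b k) / γ k := by
    intro k hk
    induction k, hk using Nat.le_induction with
    | base =>
      intro h
      have := hγ 1 le_rfl
      simp only [Finset.Icc_self, Finset.sum_singleton]
      have := ha 1 le_rfl h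
      gcongr
    | succ k hk ih =>
      intro h
      have h1 := ih (by omega)
      have h2 := hab k hk (by omega)
      have h3 := ha (k + 1) (by omega) h
      have h4 := hγ k hk
      have h5 := hγ (k + 1) (by omega)
      rw [Finset.sum_Icc_succ_top (by omega)]
      -- Shrinking the denominator is harmless because `Δ - a (k + 1)` is nonnegative.
      have h6 : (Δ - b k) / γ k ≤ (Δ - a (k + 1)) / γ (k + 1) :=
        div_le_div₀ (by linarith) (by linarith) h5 (hanti k hk)
      have h7 : (Δ - b (k + 1)) / γ (k + 1) =
          (Δ - a (k + 1)) / γ (k + 1) + (a (k + 1) - b (k + 1)) / γ (k + 1) := by ring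
      linarith
  have := hγ T hT
  exact (key T hT le_rfl).trans (by gcongr; linarith)

section Integral

variable {Ω : Type*} [MeasurableSpace Ω] {P : Measure Ω} [IsProbabilityMeasure P] {f g : Ω → ℝ}

theorem integrable_add_mul_sub_div_add (hf : Integrable f P) (hg : Integrable g P)
    (a b c d : ℝ) : Integrable (fun ω => a + b * ((f ω - g ω) / c + d)) P :=
  (integrable_const a).add ((((hf.sub hg).div_const c).add (integrable_const d)).const_mul b)

theorem integral_add_mul_sub_div_add (hf : Integrable f P) (hg : Integrable g P) (a b c d : ℝ) :
    ∫ ω, (a + b * ((f ω - g ω) / c + d)) ∂P =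
      a + b * ((∫ ω, f ω ∂P - ∫ ω, g ω ∂P) / c + d) := by
  have h1 : Integrable (fun ω => (f ω - g ω) / c) P := (hf.sub hg).div_const c
  have h2 : Integrable (fun ω => b * ((f ω - g ω) / c + d)) P :=
    (h1.add (integrable_const d)).const_mul b
  rw [integral_add (integrable_const a) h2, integral_const_mul,
    integral_add h1 (integrable_const d), integral_div, integral_sub hf hg]
  simp

end Integral

/-! ### Runs of the algorithm: measurability, conditioning and expected totals. -/

namespace CongestionGame

variable {n : ℕ} {E : Type u} [Fintype E] [DecidableEq E] (G : CongestionGame n E)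

theorem continuous_expectedCost (i : Fin n) : Continuous (G.expectedCost i) := by
  unfold expectedCost
  fun_prop

theorem measurable_exploitability : Measurable G.exploitability := by
  unfold exploitability
  refine Measurable.iSup fun i => (G.continuous_expectedCost i).measurable.sub ?_
  refine UpperSemicontinuous.measurable (upperSemicontinuous_ciInf (fun π => ?_) fun σ => ?_)
  · have : Continuous fun σ : stdSimplex ℝ (G.Strategy i) =>
        G.expectedCost i (Function.update π i σ.1) :=
      (G.continuous_expectedCost i).comp (continuous_const.update i continuous_subtype_val)
    exact (isCompact_range this).bddBelow
  · exact ((G.continuous_expectedCost i).comp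
      (continuous_id.update i continuous_const)).upperSemicontinuous

theorem measurable_gradientStep (γ : ℝ) (q : G.Profile) :
    Measurable fun x : Marginals n E => G.gradientStep γ x q := by
  refine measurable_pi_lambda _ fun i => ?_
  have h : Measurable fun x : Marginals n E => G.costEstimate i (x i) q := by
    refine (WithLp.measurable_toLp 2 (E → ℝ)).comp (measurable_pi_lambda _ fun e => ?_)
    by_cases he : e ∈ (q i).1
    · simp only [he, if_true]
      refine measurable_const.div ?_
      exact Continuous.measurable (by fun_prop)
    · simp [he]
  exact (measurable_pi_apply i).sub (h.const_smul γ)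

variable {G} in
-- A crude uniform bound, with `x` itself as competitor; it serves integrability only and does not
-- enter the rate.
theorem exists_envelope_gradientStep_le {τ : ℝ} (hτ : 0 < τ) (γ : ℝ) :
    ∃ B : ℝ, ∀ x ∈ G.jointPolytope τ, ∀ q : G.Profile,
      G.envelope (G.jointPolytope τ) (n * G.cmax) (G.gradientStep γ x q) ≤ B := by
  have hc := G.cmax_nonneg
  have hL : 0 ≤ n * G.cmax := mul_nonneg (Nat.cast_nonneg _) hc
  refine ⟨n * Fintype.card E * G.cmax + n * G.cmax *
    ∑ i : Fin n, ∑ e : E, (γ * (G.cmax * (Fintype.card E + 1 / τ))) ^ 2, fun x hx q => ?_⟩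
  refine (envelope_le (fun _ => inUnitCube_of_mem) hL _ hx).trans ?_
  refine add_le_add (G.potential_mem (inUnitCube_of_mem hx)).2
    (mul_le_mul_of_nonneg_left ?_ hL)
  refine Finset.sum_le_sum fun i _ => Finset.sum_le_sum fun e _ => ?_
  rw [gradientStep_apply]
  have h1 : x i e - γ * G.costEstimate i (x i) q e - x i e =
      -(γ * G.costEstimate i (x i) q e) := by ring
  rw [h1, neg_sq, mul_pow, mul_pow]
  refine mul_le_mul_of_nonneg_left ?_ (sq_nonneg _)
  rw [costEstimate_apply]
  split_ifs with he
  · have he' := G.mem_activeResources (q i).2 he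
    have h2 := pos_of_mem_jointPolytope hτ hx he'
    have h3 := one_div_le_of_mem_jointPolytope hτ hx he'
    have h4 : G.cost e (G.load q e) ≤ G.cmax := (G.cost_card_mem e (G.users q e)).2
    have h5 := G.cost_nonneg e (G.load q e)
    rw [div_eq_mul_one_div]
    gcongr
  · rw [zero_pow two_ne_zero]
    exact sq_nonneg _

section Run

variable {G} {γ τ : ℕ → ℝ} {T : ℕ} {Ω : Type v} [mΩ : MeasurableSpace Ω] {P : Measure Ω}
  [IsProbabilityMeasure P] {ℱ : Filtration ℕ mΩ} {x : ℕ → Ω → Fin n → EuclideanSpace ℝ E}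
  {π : ℕ → Ω → G.MixedProfile} {p : ℕ → Ω → G.Profile}

theorem IsRun.mem_jointPolytope
    (h : G.IsRun γ (fun i t => G.cappedExploration (τ t) i) T P ℱ x π p) {t : ℕ} (h1 : 1 ≤ t)
    (hT : t ≤ T) (ω : Ω) : x t ω ∈ G.jointPolytope (τ t) := by
  intro i
  obtain rfl | ⟨s, hs, rfl⟩ : t = 1 ∨ ∃ s, 1 ≤ s ∧ t = s + 1 := by
    rcases h1.eq_or_lt with h | h
    · exact Or.inl h.symm
    · exact Or.inr ⟨t - 1, by omega, by omega⟩
  · exact h.initial hT ω i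
  · exact (h.update s hs (by omega) ω i).1

theorem IsRun.isMarginal {μ : Fin n → ℕ → ℝ} (h : G.IsRun γ μ T P ℱ x π p) {t : ℕ} (h1 : 1 ≤ t)
    (hT : t ≤ T) (ω : Ω) : G.IsMarginal (π t ω) (x t ω) :=
  ⟨fun i => (h.decomposition t h1 hT ω i).1, fun i => (h.decomposition t h1 hT ω i).2.2⟩

/-- Conditional sampling: realized profiles can be replaced by their conditional probabilities. -/
theorem IsRun.integral_indicator_mul {μ : Fin n → ℕ → ℝ} (h : G.IsRun γ μ T P ℱ x π p) {t : ℕ}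
    (h1 : 1 ≤ t) (hT : t ≤ T) (q : G.Profile) {f : Ω → ℝ} (hf : Measurable[ℱ t] f) {B : ℝ}
    (hB : ∀ ω, |f ω| ≤ B) :
    ∫ ω, ({ω | p t ω = q}).indicator (fun _ => (1 : ℝ)) ω * f ω ∂P =
      ∫ ω, (∏ j, π t ω j (q j)) * f ω ∂P := by
  have hmeas : MeasurableSet {ω | p t ω = q} := ℱ.le (t + 1) _ (h.measurable_p t h1 hT q)
  have hI : Integrable (({ω | p t ω = q}).indicator (fun _ => (1 : ℝ))) P :=
    (integrable_const 1).indicator hmeas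
  have hfI : Integrable f P :=
    Integrable.of_bound (hf.mono (ℱ.le t) le_rfl).aestronglyMeasurable B
      (Filter.Eventually.of_forall hB)
  have hprod : Integrable (({ω | p t ω = q}).indicator (fun _ => (1 : ℝ)) * f) P := by
    refine hI.mul_bdd (c := B) (hf.mono (ℱ.le t) le_rfl).aestronglyMeasurable ?_
    exact Filter.Eventually.of_forall hB
  have h2 := condExp_mul_of_stronglyMeasurable_right (m := ℱ t) (μ := P)
    hf.stronglyMeasurable hprod hI
  have h3 := integral_condExp (μ := P) (ℱ.le t)
    (f := ({ω | p t ω = q}).indicator (fun _ => (1 : ℝ)) * f)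
  simp only [Pi.mul_apply] at h3
  rw [← h3]
  refine integral_congr_ae ?_
  filter_upwards [h2, h.sampling t h1 hT q] with ω hω hω'
  rw [hω, Pi.mul_apply, hω']

theorem IsRun.measurable_prod {μ : Fin n → ℕ → ℝ} (h : G.IsRun γ μ T P ℱ x π p) {t : ℕ}
    (h1 : 1 ≤ t) (hT : t ≤ T) (q : G.Profile) :
    Measurable[ℱ t] fun ω => ∏ j, π t ω j (q j) := by
  refine Finset.measurable_prod _ fun j _ => ?_
  exact (measurable_pi_apply (q j)).comp ((measurable_pi_apply j).comp (h.measurable_π t h1 hT))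

theorem IsMarginal.prod_le_one {π : G.MixedProfile} {x : Marginals n E} (h : G.IsMarginal π x)
    (q : G.Profile) : ∏ j, π j (q j) ≤ 1 := by
  rw [← h.sum_prod]
  exact Finset.single_le_sum (f := fun q : G.Profile => ∏ j, π j (q j))
    (fun q _ => h.prod_nonneg q) (Finset.mem_univ q)

theorem IsRun.integrable_envelope {μ : Fin n → ℕ → ℝ} (h : G.IsRun γ μ T P ℱ x π p) {t : ℕ} {σ : ℝ}
    (h1 : 1 ≤ t) (hT : t ≤ T)
    (hσ : ∀ ω, x t ω ∈ G.jointPolytope σ) :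
    Integrable (fun ω => G.envelope (G.jointPolytope σ) (n * G.cmax) (x t ω)) P := by
  have hL : 0 ≤ n * G.cmax := mul_nonneg (Nat.cast_nonneg _) G.cmax_nonneg
  refine Integrable.of_bound (C := n * Fintype.card E * G.cmax)
    (((measurable_envelope (fun _ => inUnitCube_of_mem) hL).comp
      (h.measurable_x t h1 hT)).mono (ℱ.le t) le_rfl).aestronglyMeasurable
      (Filter.Eventually.of_forall fun ω => ?_)
  rw [Real.norm_eq_abs,
    abs_of_nonneg (envelope_nonneg (fun _ => inUnitCube_of_mem) hL _)]
  exact envelope_le_of_mem (fun _ => inUnitCube_of_mem) hL (hσ ω)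

theorem IsRun.integrable_exploitability {μ : Fin n → ℕ → ℝ} (h : G.IsRun γ μ T P ℱ x π p) {t : ℕ}
    (h1 : 1 ≤ t) (hT : t ≤ T) :
    Integrable (fun ω => G.exploitability (π t ω)) P := by
  refine Integrable.of_bound (C := Fintype.card E * G.cmax)
    ((G.measurable_exploitability.comp (h.measurable_π t h1 hT)).mono (ℱ.le t)
      le_rfl).aestronglyMeasurable (Filter.Eventually.of_forall fun ω => ?_)
  have hm := h.isMarginal h1 hT ω
  rw [Real.norm_eq_abs, abs_of_nonneg (exploitability_nonneg hm)]
  exact exploitability_le_card_mul_cmax hm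

section Rounds

variable (h : G.IsRun γ (fun i t => G.cappedExploration (τ t) i) T P ℱ x π p)
  (hτ : ∀ t, 1 ≤ t → 0 < τ t) (hτanti : ∀ t, 1 ≤ t → τ (t + 1) ≤ τ t) {t : ℕ}

include h hτ hτanti

/-- Round `t` projects onto the polytope with parameter `τ (t + 1)`, so its envelope must be taken
there; decreasing exploration makes `x t` feasible for it. -/
theorem IsRun.mem_jointPolytope_succ (h1 : 1 ≤ t) (hT : t ≤ T) (ω : Ω) :
    x t ω ∈ G.jointPolytope (τ (t + 1)) :=
  G.jointPolytope_anti (hτanti t h1) (h.mem_jointPolytope h1 hT ω)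

theorem IsRun.measurable_envelope_gradientStep (h1 : 1 ≤ t) (hT : t ≤ T) (q : G.Profile) :
    Measurable[ℱ t] fun ω => G.envelope (G.jointPolytope (τ (t + 1))) (n * G.cmax)
      (G.gradientStep (γ t) (x t ω) q) :=
  (measurable_envelope (fun _ => inUnitCube_of_mem)
    (mul_nonneg (Nat.cast_nonneg _) G.cmax_nonneg)).comp
      ((G.measurable_gradientStep (γ t) q).comp (h.measurable_x t h1 hT))

theorem IsRun.exists_abs_envelope_gradientStep_le (h1 : 1 ≤ t) (hT : t ≤ T) :
    ∃ B : ℝ, ∀ ω q, |G.envelope (G.jointPolytope (τ (t + 1))) (n * G.cmax)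
      (G.gradientStep (γ t) (x t ω) q)| ≤ B := by
  obtain ⟨B, hB⟩ := exists_envelope_gradientStep_le (G := G) (hτ (t + 1) (by omega)) (γ t)
  refine ⟨B, fun ω q => ?_⟩
  rw [abs_of_nonneg (envelope_nonneg (fun _ => inUnitCube_of_mem)
    (mul_nonneg (Nat.cast_nonneg _) G.cmax_nonneg) _)]
  exact hB _ (h.mem_jointPolytope_succ hτ hτanti h1 hT ω) q

theorem IsRun.integrable_prod_mul_envelope (h1 : 1 ≤ t) (hT : t ≤ T) (q : G.Profile) :
    Integrable (fun ω => (∏ j, π t ω j (q j)) *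
      G.envelope (G.jointPolytope (τ (t + 1))) (n * G.cmax)
        (G.gradientStep (γ t) (x t ω) q)) P := by
  obtain ⟨B, hB⟩ := h.exists_abs_envelope_gradientStep_le hτ hτanti h1 hT
  refine Integrable.of_bound (C := B) (((h.measurable_prod h1 hT q).mul
    (h.measurable_envelope_gradientStep hτ hτanti h1 hT q)).mono (ℱ.le t)
      le_rfl).aestronglyMeasurable (Filter.Eventually.of_forall fun ω => ?_)
  have hm := h.isMarginal h1 hT ω
  rw [Real.norm_eq_abs, abs_mul, abs_of_nonneg (hm.prod_nonneg q)]
  exact (mul_le_of_le_one_left (abs_nonneg _) (hm.prod_le_one q)).trans (hB ω q)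

/-- The expected envelope after a round is at most the one after the unprojected step. -/
theorem IsRun.integral_envelope_succ_le (h1 : 1 ≤ t) (hT : t < T) :
    ∫ ω, G.envelope (G.jointPolytope (τ (t + 2))) (n * G.cmax) (x (t + 1) ω) ∂P ≤
      ∫ ω, ∑ q : G.Profile, (∏ j, π t ω j (q j)) *
        G.envelope (G.jointPolytope (τ (t + 1))) (n * G.cmax)
          (G.gradientStep (γ t) (x t ω) q) ∂P := by
  classical
  have hL : 0 ≤ n * G.cmax := mul_nonneg (Nat.cast_nonneg _) G.cmax_nonneg
  obtain ⟨B, hB⟩ := h.exists_abs_envelope_gradientStep_le hτ hτanti h1 hT.le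
  have hmeas := fun q => h.measurable_envelope_gradientStep hτ hτanti h1 hT.le q
  have hI : ∀ q, Integrable (fun ω => ({ω | p t ω = q}).indicator (fun _ => (1 : ℝ)) ω *
      G.envelope (G.jointPolytope (τ (t + 1))) (n * G.cmax)
        (G.gradientStep (γ t) (x t ω) q)) P := fun q =>
    ((integrable_const (1 : ℝ)).indicator
      (ℱ.le (t + 1) _ (h.measurable_p t h1 hT.le q))).mul_bdd (c := B)
      ((hmeas q).mono (ℱ.le t) le_rfl).aestronglyMeasurable
      (Filter.Eventually.of_forall fun ω => hB ω q)
  rw [integral_finsetSum _ fun q _ => h.integrable_prod_mul_envelope hτ hτanti h1 hT.le q]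
  simp_rw [← h.integral_indicator_mul h1 hT.le _ (hmeas _) fun ω => hB ω _]
  rw [← integral_finsetSum _ fun q _ => hI q]
  refine integral_mono (h.integrable_envelope (by omega) hT fun ω =>
    h.mem_jointPolytope_succ hτ hτanti (by omega) hT ω) (integrable_finsetSum _ fun q _ => hI q)
    fun ω => ?_
  have hsum : ∑ q : G.Profile, ({ω | p t ω = q}).indicator (fun _ => (1 : ℝ)) ω *
      G.envelope (G.jointPolytope (τ (t + 1))) (n * G.cmax) (G.gradientStep (γ t) (x t ω) q) =
      G.envelope (G.jointPolytope (τ (t + 1))) (n * G.cmax)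
        (G.gradientStep (γ t) (x t ω) (p t ω)) := by
    rw [Finset.sum_eq_single (p t ω)]
    · simp
    · intro q _ hq
      simp [hq.symm]
    · simp
  have hmem := h.mem_jointPolytope (t := t + 1) (by omega) hT ω
  calc _ ≤ G.envelope (G.jointPolytope (τ (t + 1))) (n * G.cmax) (x (t + 1) ω) :=
        envelope_anti (fun _ => inUnitCube_of_mem) hL
          (G.jointPolytope_anti (hτanti (t + 1) (by omega))) ⟨_, hmem⟩ _
    _ ≤ G.envelope (G.jointPolytope (τ (t + 1))) (n * G.cmax)
        (G.gradientStep (γ t) (x t ω) (p t ω)) :=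
        G.envelope_projection_le hL fun i => h.update t h1 hT ω i
    _ = _ := hsum.symm

/-- The bound on the expected total exploitability for general step sizes and exploration
parameters. -/
theorem IsRun.sum_integral_exploitability_le (hγ : ∀ t, 1 ≤ t → 0 < γ t)
    (hγanti : ∀ t, 1 ≤ t → γ (t + 1) ≤ γ t) (hT : 1 ≤ T) {η : ℝ} (hη : 0 < η) :
    ∑ t ∈ Finset.Icc 1 T, ∫ ω, G.exploitability (π t ω) ∂P ≤
      T * (1 / (4 * η)) + (Fintype.card E : ℝ) ^ 2 * G.cmax * ∑ t ∈ Finset.Icc 1 T, τ (t + 1) +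
      8 * Fintype.card E * η * (n * Fintype.card E * G.cmax / γ T +
        n * G.cmax * (n * Fintype.card E * G.cmax ^ 2) *
          ∑ t ∈ Finset.Icc 1 T, γ t * (Fintype.card E + 1 / τ (t + 1))) := by
  have hL : 0 ≤ n * G.cmax := mul_nonneg (Nat.cast_nonneg _) G.cmax_nonneg
  set a : ℕ → ℝ := fun t =>
    ∫ ω, G.envelope (G.jointPolytope (τ (t + 1))) (n * G.cmax) (x t ω) ∂P
  set b : ℕ → ℝ := fun t => ∫ ω, ∑ q : G.Profile, (∏ j, π t ω j (q j)) *
    G.envelope (G.jointPolytope (τ (t + 1))) (n * G.cmax) (G.gradientStep (γ t) (x t ω) q) ∂P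
  have habel := Finset.sum_Icc_sub_div_le (a := a) (b := b) (Δ := n * Fintype.card E * G.cmax)
    hT hγ hγanti (fun t h1 ht => by
      have := integral_mono (h.integrable_envelope h1 ht fun ω =>
        h.mem_jointPolytope_succ hτ hτanti h1 ht ω) (integrable_const (μ := P) _) fun ω =>
        envelope_le_of_mem (fun _ => inUnitCube_of_mem) hL
          (h.mem_jointPolytope_succ hτ hτanti h1 ht ω)
      simpa using this)
    (fun t h1 ht => h.integral_envelope_succ_le hτ hτanti h1 ht)
    (integral_nonneg fun ω => Finset.sum_nonneg fun q _ =>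
      mul_nonneg ((h.isMarginal hT le_rfl ω).prod_nonneg q)
        (envelope_nonneg (fun _ => inUnitCube_of_mem) hL _))
  have hstep : ∀ t ∈ Finset.Icc 1 T, ∫ ω, G.exploitability (π t ω) ∂P ≤
      1 / (4 * η) + (Fintype.card E : ℝ) ^ 2 * G.cmax * τ (t + 1) +
      8 * Fintype.card E * η * ((a t - b t) / γ t +
        n * G.cmax * (n * Fintype.card E * G.cmax ^ 2) *
          (γ t * (Fintype.card E + 1 / τ (t + 1)))) := by
    intro t ht
    obtain ⟨h1, h2⟩ := Finset.mem_Icc.1 ht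
    have hIa := h.integrable_envelope h1 h2 fun ω =>
      h.mem_jointPolytope_succ hτ hτanti h1 h2 ω
    have hIb := integrable_finsetSum Finset.univ fun q _ =>
      h.integrable_prod_mul_envelope hτ hτanti h1 h2 q
    have hle := integral_mono (h.integrable_exploitability h1 h2)
      (integrable_add_mul_sub_div_add hIa hIb _ _ _ _) fun ω =>
        exploitability_le_envelope_decrease (h.isMarginal h1 h2 ω)
          (hτ (t + 1) (by omega)) (h.mem_jointPolytope_succ hτ hτanti h1 h2 ω) (hγ t h1) hη
    refine hle.trans_eq ?_
    rw [integral_add_mul_sub_div_add hIa hIb]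
    ring
  refine (Finset.sum_le_sum hstep).trans ?_
  rw [Finset.sum_add_distrib, Finset.sum_add_distrib, ← Finset.mul_sum, ← Finset.mul_sum,
    Finset.sum_add_distrib, ← Finset.mul_sum]
  simp only [Finset.sum_const, Nat.card_Icc, add_tsub_cancel_right, nsmul_eq_mul]
  have hη8 : 0 ≤ 8 * Fintype.card E * η := by positivity
  gcongr

end Rounds

end Run

end CongestionGame

/-! ### Power sums and the rate of convergence. -/

theorem Real.sum_Icc_rpow_neg_le {s : ℝ} (hs0 : 0 ≤ s) (hs1 : s < 1) (T : ℕ) :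
    ∑ t ∈ Finset.Icc 1 T, (t : ℝ) ^ (-s) ≤ (T : ℝ) ^ (1 - s) / (1 - s) := by
  have hs : 0 < 1 - s := by linarith
  induction T with
  | zero => simp [Real.zero_rpow hs.ne']
  | succ k ih =>
    rw [Finset.sum_Icc_succ_top (by omega)]
    refine (add_le_add_left ih _).trans ?_
    have hk : (0 : ℝ) < ((k + 1 : ℕ) : ℝ) := by positivity
    have hk' : (k : ℝ) = ((k + 1 : ℕ) : ℝ) - 1 := by push_cast; ring
    have h1 : (1 : ℝ) ≤ ((k + 1 : ℕ) : ℝ) := by exact_mod_cast Nat.succ_pos k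
    set r : ℝ := ((k + 1 : ℕ) : ℝ)
    -- Bernoulli's inequality for the exponent `1 - s ≤ 1` replaces the comparison with an integral.
    have hb := rpow_one_add_le_one_add_mul_self (s := -(1 / r)) (p := 1 - s)
      (by rw [neg_le_neg_iff, div_le_one hk]; exact h1) hs.le (by linarith)
    have h2 : (k : ℝ) = r * (1 + -(1 / r)) := by rw [hk']; field_simp; ring
    have h3 : 0 ≤ 1 + -(1 / r) := by
      have : 1 / r ≤ 1 := by rw [div_le_one hk]; exact h1
      linarith
    have h4 : r ^ (1 - s) = r * r ^ (-s) := by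
      rw [sub_eq_add_neg, Real.rpow_add hk, Real.rpow_one]
    have h5 : (k : ℝ) ^ (1 - s) ≤ r ^ (1 - s) - (1 - s) * r ^ (-s) := by
      rw [h2, Real.mul_rpow hk.le h3]
      calc _ ≤ r ^ (1 - s) * (1 + (1 - s) * -(1 / r)) := by gcongr
        _ = _ := by rw [h4]; field_simp; ring
    rw [div_add' _ _ _ hs.ne']
    gcongr
    linarith

/-- Passing to a `d`-th root turns the fractional exponents into natural ones, which `ring` and
`gcongr` can handle. -/
theorem Real.exists_pow_eq_rpow (d : ℕ) (hd : d ≠ 0) {r : ℝ} (hr : 1 ≤ r) :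
    ∃ R : ℝ, 1 ≤ R ∧ r = R ^ d ∧ ∀ (k : ℕ) (s : ℝ), s = (1 / d) * k → r ^ s = R ^ k := by
  have hr0 : 0 ≤ r := by linarith
  refine ⟨r ^ (1 / d : ℝ), Real.one_le_rpow hr (by positivity), ?_, fun k s hs => ?_⟩
  · rw [one_div, Real.rpow_inv_natCast_pow hr0 hd]
  · rw [hs, Real.rpow_mul hr0, Real.rpow_natCast]

namespace CongestionGame

variable {n : ℕ} {E : Type u} [Fintype E] [DecidableEq E] {G : CongestionGame n E}
  {γ τ : ℕ → ℝ} {T : ℕ} {Ω : Type v} [mΩ : MeasurableSpace Ω] {P : Measure Ω}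
  [IsProbabilityMeasure P] {ℱ : Filtration ℕ mΩ} {x : ℕ → Ω → Fin n → EuclideanSpace ℝ E}
  {π : ℕ → Ω → G.MixedProfile} {p : ℕ → Ω → G.Profile}

theorem IsRun.avgExploitabilityLE {μ : Fin n → ℕ → ℝ} (h : G.IsRun γ μ T P ℱ x π p) {ε : ℝ}
    (hle : 1 / (T : ℝ) * ∑ t ∈ Finset.Icc 1 T, ∫ ω, G.exploitability (π t ω) ∂P ≤ ε) :
    G.AvgExploitabilityLE P π T ε := by
  have hI : ∀ t ∈ Finset.Icc 1 T, Integrable (fun ω => G.exploitability (π t ω)) P :=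
    fun t ht => h.integrable_exploitability (Finset.mem_Icc.1 ht).1 (Finset.mem_Icc.1 ht).2
  refine ⟨integrable_finsetSum _ hI, ?_⟩
  rwa [integral_finsetSum _ hI]

/-- Degenerate games, in which no agent can ever gain anything. -/
theorem IsRun.avgExploitabilityLE_of_trivial {μ : Fin n → ℕ → ℝ} (h : G.IsRun γ μ T P ℱ x π p)
    {ε : ℝ} (hε : 0 < ε) (h0 : n = 0 ∨ Fintype.card E * G.cmax = 0 ∨ T = 0) :
    G.AvgExploitabilityLE P π T ε := by
  refine h.avgExploitabilityLE ?_
  rw [Finset.sum_eq_zero, mul_zero]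
  · exact hε.le
  intro t ht
  obtain ⟨h1, h2⟩ := Finset.mem_Icc.1 ht
  refine integral_eq_zero_of_ae (Filter.Eventually.of_forall fun ω => ?_)
  have hm := h.isMarginal h1 h2 ω
  refine le_antisymm ?_ (exploitability_nonneg hm)
  rcases h0 with rfl | h0 | h0
  · exact exploitability_le hm le_rfl fun i => i.elim0
  · exact (exploitability_le_card_mul_cmax hm).trans_eq h0
  · omega

/-- Convergence for step sizes `α t^(-3/5)` and exploration parameters `β t^(-1/5)`. -/
theorem IsRun.avgExploitabilityLE_of_rpow
    (h : G.IsRun γ (fun i t => G.cappedExploration (τ t) i) T P ℱ x π p) {α β ε : ℝ}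
    (hα : 0 < α) (hβ : 0 < β) (hγ : ∀ t : ℕ, γ t = α * (t : ℝ) ^ (-(3 / 5) : ℝ))
    (hτ : ∀ t : ℕ, τ t = β * (t : ℝ) ^ (-(1 / 5) : ℝ)) (hε : 0 < ε) (hT : 1 ≤ T)
    (h1 : 5 * ((Fintype.card E : ℝ) ^ 2 * G.cmax * β) ≤ ε * (T : ℝ) ^ (1 / 5 : ℝ))
    (h2 : 16 * Fintype.card E * (n * Fintype.card E * G.cmax / α +
      n * G.cmax * (n * Fintype.card E * G.cmax ^ 2) *
        (α * (5 / 2 * Fintype.card E + 10 / 3 / β))) ≤ (ε * (T : ℝ) ^ (1 / 5 : ℝ)) ^ 2) :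
    G.AvgExploitabilityLE P π T ε := by
  refine h.avgExploitabilityLE ?_
  have hc := G.cmax_nonneg
  have anti : ∀ {s : ℝ}, 0 ≤ s → ∀ t : ℕ, 1 ≤ t → ((t + 1 : ℕ) : ℝ) ^ (-s) ≤ (t : ℝ) ^ (-s) :=
    fun hs t ht => Real.rpow_le_rpow_of_nonpos (by exact_mod_cast ht) (by push_cast; linarith)
      (by linarith)
  have hτpos : ∀ t, 1 ≤ t → 0 < τ t := fun t ht => by
    have : (0 : ℝ) < t := by exact_mod_cast ht
    rw [hτ]; positivity
  have hτanti : ∀ t, 1 ≤ t → τ (t + 1) ≤ τ t := fun t ht => by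
    rw [hτ, hτ]; gcongr β * ?_; exact anti (by norm_num) t ht
  have hγpos : ∀ t, 1 ≤ t → 0 < γ t := fun t ht => by
    have : (0 : ℝ) < t := by exact_mod_cast ht
    rw [hγ]; positivity
  have hγanti : ∀ t, 1 ≤ t → γ (t + 1) ≤ γ t := fun t ht => by
    rw [hγ, hγ]; gcongr α * ?_; exact anti (by norm_num) t ht
  -- With `η = 1 / ε` the first term is a quarter of the budget `ε * T`; `h1` and `h2` give a
  -- quarter to exploration and a half to the rest.
  have key := h.sum_integral_exploitability_le hτpos hτanti hγpos hγanti hT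
    (η := 1 / ε) (by positivity)
  have hT0 : (0 : ℝ) < T := by exact_mod_cast hT
  set w := (T : ℝ) ^ (1 / 5 : ℝ)
  have hw : 1 ≤ w := Real.one_le_rpow (by exact_mod_cast hT) (by norm_num)
  have hpow : ∀ (k : ℕ) (r : ℝ), r = (1 / 5) * k → (T : ℝ) ^ r = w ^ k := fun k r hr => by
    rw [hr, Real.rpow_mul hT0.le, Real.rpow_natCast]
  have hTw : (T : ℝ) = w ^ 5 := by
    rw [← hpow 5 1 (by norm_num), Real.rpow_one]
  have hγT : γ T = α / w ^ 3 := by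
    rw [hγ, Real.rpow_neg hT0.le, hpow 3 _ (by norm_num)]; rfl
  have s1 : ∑ t ∈ Finset.Icc 1 T, τ (t + 1) ≤ β * (5 / 4 * w ^ 4) := by
    calc _ ≤ ∑ t ∈ Finset.Icc 1 T, β * (t : ℝ) ^ (-(1 / 5) : ℝ) :=
          Finset.sum_le_sum fun t ht =>
            (hτanti t (Finset.mem_Icc.1 ht).1).trans_eq (hτ t)
      _ ≤ β * ((T : ℝ) ^ (1 - 1 / 5 : ℝ) / (1 - 1 / 5)) := by
          rw [← Finset.mul_sum]
          gcongr
          exact Real.sum_Icc_rpow_neg_le (by norm_num) (by norm_num) T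
      _ = _ := by rw [hpow 4 _ (by norm_num)]; ring
  have s2 : ∑ t ∈ Finset.Icc 1 T, γ t * (Fintype.card E + 1 / τ (t + 1)) ≤
      α * (5 / 2 * Fintype.card E + 10 / 3 / β) * w ^ 3 := by
    have hterm : ∀ t ∈ Finset.Icc 1 T, γ t * (Fintype.card E + 1 / τ (t + 1)) ≤
        α * Fintype.card E * (t : ℝ) ^ (-(3 / 5) : ℝ) +
          2 * α / β * (t : ℝ) ^ (-(2 / 5) : ℝ) := by
      intro t ht
      have ht1 : (1 : ℝ) ≤ t := by exact_mod_cast (Finset.mem_Icc.1 ht).1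
      have ht0 : (0 : ℝ) < t := by linarith
      -- The factor 2 absorbs the shift from `t` to `t + 1`; divided by `1 - 2/5` it gives the `10 /
      -- 3` of the statement.
      have e1 : 1 / τ (t + 1) ≤ 2 / β * (t : ℝ) ^ (1 / 5 : ℝ) := by
        have e2 : 1 / τ (t + 1) = 1 / β * ((t + 1 : ℕ) : ℝ) ^ (1 / 5 : ℝ) := by
          rw [hτ, Real.rpow_neg (by positivity)]
          have : (0 : ℝ) < ((t + 1 : ℕ) : ℝ) ^ (1 / 5 : ℝ) := by positivity
          field_simp
        have e3 : ((t + 1 : ℕ) : ℝ) ^ (1 / 5 : ℝ) ≤ 2 * (t : ℝ) ^ (1 / 5 : ℝ) := by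
          calc _ ≤ (2 * (t : ℝ)) ^ (1 / 5 : ℝ) := by
                gcongr; push_cast; linarith
            _ = (2 : ℝ) ^ (1 / 5 : ℝ) * (t : ℝ) ^ (1 / 5 : ℝ) :=
                Real.mul_rpow (by norm_num) ht0.le
            _ ≤ (2 : ℝ) ^ (1 : ℝ) * (t : ℝ) ^ (1 / 5 : ℝ) := by
                gcongr <;> norm_num
            _ = _ := by rw [Real.rpow_one]
        rw [e2]
        calc _ ≤ 1 / β * (2 * (t : ℝ) ^ (1 / 5 : ℝ)) := by gcongr
          _ = _ := by ring
      have e4 : (t : ℝ) ^ (-(2 / 5) : ℝ) = (t : ℝ) ^ (-(3 / 5) : ℝ) * (t : ℝ) ^ (1 / 5 : ℝ) := by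
        rw [← Real.rpow_add ht0]; norm_num
      have e5 := mul_le_mul_of_nonneg_left (add_le_add_right e1 (Fintype.card E : ℝ))
        (hγpos t (Finset.mem_Icc.1 ht).1).le
      refine e5.trans_eq ?_
      rw [e4, hγ]; ring
    refine (Finset.sum_le_sum hterm).trans ?_
    rw [Finset.sum_add_distrib, ← Finset.mul_sum, ← Finset.mul_sum]
    have f1 := Real.sum_Icc_rpow_neg_le (s := 3 / 5) (by norm_num) (by norm_num) T
    have f2 := Real.sum_Icc_rpow_neg_le (s := 2 / 5) (by norm_num) (by norm_num) T
    rw [hpow 2 _ (by norm_num)] at f1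
    rw [hpow 3 _ (by norm_num)] at f2
    have f3 : w ^ 2 ≤ w ^ 3 := pow_le_pow_right₀ hw (by norm_num)
    calc _ ≤ α * Fintype.card E * (w ^ 3 / (1 - 3 / 5)) +
          2 * α / β * (w ^ 3 / (1 - 2 / 5)) := by
          gcongr
          exact f1.trans (by gcongr)
      _ = _ := by field_simp; ring
  set X := n * Fintype.card E * G.cmax / α + n * G.cmax * (n * Fintype.card E * G.cmax ^ 2) *
    (α * (5 / 2 * Fintype.card E + 10 / 3 / β))
  have hw0 : 0 < w := by linarith
  have t1 : (Fintype.card E : ℝ) ^ 2 * G.cmax * ∑ t ∈ Finset.Icc 1 T, τ (t + 1) ≤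
      ε / 4 * w ^ 5 := by
    calc _ ≤ (Fintype.card E : ℝ) ^ 2 * G.cmax * (β * (5 / 4 * w ^ 4)) := by gcongr
      _ = 5 * ((Fintype.card E : ℝ) ^ 2 * G.cmax * β) * (w ^ 4 / 4) := by ring
      _ ≤ ε * w * (w ^ 4 / 4) := by gcongr
      _ = _ := by ring
  have t2 : 8 * Fintype.card E * (1 / ε) * (n * Fintype.card E * G.cmax / γ T +
      n * G.cmax * (n * Fintype.card E * G.cmax ^ 2) *
          ∑ t ∈ Finset.Icc 1 T, γ t * (Fintype.card E + 1 / τ (t + 1))) ≤ ε / 2 * w ^ 5 := by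
    calc _ ≤ 8 * Fintype.card E * (1 / ε) * (n * Fintype.card E * G.cmax / γ T +
          n * G.cmax * (n * Fintype.card E * G.cmax ^ 2) *
          (α * (5 / 2 * Fintype.card E + 10 / 3 / β) * w ^ 3)) := by gcongr
      _ = 16 * Fintype.card E * X * (w ^ 3 / (2 * ε)) := by
          rw [hγT]; simp only [X]; field_simp; ring
      _ ≤ (ε * w) ^ 2 * (w ^ 3 / (2 * ε)) := by gcongr
      _ = _ := by field_simp
  have t3 : (T : ℝ) * (1 / (4 * (1 / ε))) = ε / 4 * w ^ 5 := by
    rw [hTw]; field_simp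
  rw [one_div_mul_eq_div, div_le_iff₀ hT0]
  refine key.trans ?_
  rw [t3]
  calc _ ≤ ε / 4 * w ^ 5 + ε / 4 * w ^ 5 + ε / 2 * w ^ 5 := by gcongr
    _ = ε * T := by rw [hTw]; ring

/-- The lower bound on the fifth root of the number of rounds. -/
theorem mul_le_mul_rpow_one_fifth {κ ε Q : ℝ} (hε : 0 < ε) {T : ℕ}
    (h : κ ^ 5 * (Q ^ 5 / ε ^ 5) ≤ T) : κ * Q ≤ ε * (T : ℝ) ^ (1 / 5 : ℝ) := by
  have hw : ((T : ℝ) ^ (1 / 5 : ℝ)) ^ 5 = T := by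
    rw [← Real.rpow_natCast, ← Real.rpow_mul (Nat.cast_nonneg T)]; norm_num
  have h1 : (κ * Q / ε) ^ 5 ≤ ((T : ℝ) ^ (1 / 5 : ℝ)) ^ 5 := by
    rw [hw, div_pow, mul_pow, mul_div_assoc]; exact h
  have h2 : κ * Q / ε ≤ (T : ℝ) ^ (1 / 5 : ℝ) :=
    -- An odd power is monotone on all of ℝ, so no sign of `κ * Q` is needed.
    (Odd.strictMono_pow (by decide : Odd 5)).le_iff_le.1 h1
  rwa [div_le_iff₀' hε] at h2

end CongestionGame

end

/-! ### The two parameter choices. -/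

theorem theorem3p7 (C : ℝ) :
    (∃ K : ℝ, 0 < K ∧
      ∀ (n : ℕ) (E : Type u) [Fintype E] [DecidableEq E] (G : CongestionGame n E),
        G.cmax ≤ C →
      ∀ (ε : ℝ), 0 < ε →
      ∀ (T : ℕ),
        K * ((Fintype.card E : ℝ) ^ (25 / 2 : ℝ) * (n : ℝ) ^ (15 / 2 : ℝ) / ε ^ 5) ≤ T →
      ∀ (Ω : Type v) [mΩ : MeasurableSpace Ω] (P : Measure Ω) [IsProbabilityMeasure P]
        (ℱ : Filtration ℕ mΩ) (x : ℕ → Ω → Fin n → EuclideanSpace ℝ E)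
        (π : ℕ → Ω → G.MixedProfile) (p : ℕ → Ω → G.Profile),
        G.IsRun CongestionGame.stepSize G.exploration T P ℱ x π p →
        G.AvgExploitabilityLE P π T ε) ∧
    (∀ a b : ℝ, 0 < a → 0 < b → ∃ K : ℝ, 0 < K ∧
      ∀ (n : ℕ) (E : Type u) [Fintype E] [DecidableEq E] (G : CongestionGame n E),
        G.cmax ≤ C →
      ∀ (ε : ℝ), 0 < ε →
      ∀ (T : ℕ),
        K * ((n : ℝ) ^ (13 / 2 : ℝ) * (Fintype.card E : ℝ) ^ 7 / ε ^ 5) ≤ T →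
      ∀ (Ω : Type v) [mΩ : MeasurableSpace Ω] (P : Measure Ω) [IsProbabilityMeasure P]
        (ℱ : Filtration ℕ mΩ) (x : ℕ → Ω → Fin n → EuclideanSpace ℝ E)
        (π : ℕ → Ω → G.MixedProfile) (p : ℕ → Ω → G.Profile),
        G.IsRun (G.tunedStepSize a) (G.tunedExploration b) T P ℱ x π p →
        G.AvgExploitabilityLE P π T ε) := by
  -- `1 ≤ D` lets lower powers of the cost bound be absorbed into higher ones.
  set D := max C 1
  have hD1 : 1 ≤ D := le_max_right _ _
  have hD0 : 0 < D := by linarith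
  constructor
  · refine ⟨(11 * D ^ 2) ^ 5, by positivity, ?_⟩
    intro n E _ _ G hC ε hε T hKT Ω _ P _ ℱ x π p h
    -- The lower bound on `T` carries no information when `n` or `m` is 0, and positivity of `cmax`
    -- is needed for the tuned step size.
    by_cases h0 : n = 0 ∨ Fintype.card E * G.cmax = 0 ∨ T = 0
    · exact h.avgExploitabilityLE_of_trivial hε h0
    push Not at h0
    obtain ⟨hn, hmc, hT⟩ := h0
    have hm1 : (1 : ℝ) ≤ Fintype.card E := by
      have : Fintype.card E ≠ 0 := fun h => hmc (by rw [h]; simp)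
      exact_mod_cast Nat.one_le_iff_ne_zero.2 this
    have hn1 : (1 : ℝ) ≤ n := by exact_mod_cast Nat.one_le_iff_ne_zero.2 hn
    have hcD : G.cmax ≤ D := hC.trans (le_max_left _ _)
    have hc := G.cmax_nonneg
    obtain ⟨M, hM, hmM, hMpow⟩ := Real.exists_pow_eq_rpow 2 (by norm_num) hm1
    obtain ⟨N, hN, hnN, hNpow⟩ := Real.exists_pow_eq_rpow 2 (by norm_num) hn1
    rw [hMpow 25 _ (by norm_num), hNpow 15 _ (by norm_num)] at hKT
    have hw := CongestionGame.mul_le_mul_rpow_one_fifth (κ := 11 * D ^ 2) (Q := M ^ 5 * N ^ 3) hε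
      (by convert hKT using 3; ring)
    refine h.avgExploitabilityLE_of_rpow
      (τ := fun t => (t : ℝ) ^ (-(1 / 5) : ℝ)) (α := 1) (β := 1) one_pos one_pos
      (fun t => (one_mul _).symm) (fun t => (one_mul _).symm) hε (Nat.one_le_iff_ne_zero.2 hT)
      (le_trans ?_ hw) (le_trans ?_ (pow_le_pow_left₀ (by positivity) hw 2)) <;>
      rw [hmM] <;> try rw [hnN]
    · calc 5 * ((M ^ 2) ^ 2 * G.cmax * 1) ≤ 5 * ((M ^ 2) ^ 2 * D * 1) := by gcongr
        _ = 5 * D * (M ^ 4 * 1) := by ring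
        _ ≤ 11 * D ^ 2 * (M ^ 5 * N ^ 3) := by
          gcongr
          · norm_num
          · exact le_self_pow₀ hD1 (by norm_num)
          · norm_num
          · exact one_le_pow₀ hN
    · have e1 : N ^ 2 * M ^ 4 * D ≤ M ^ 10 * N ^ 6 * D ^ 4 := by
        calc N ^ 2 * M ^ 4 * D = M ^ 4 * N ^ 2 * D ^ 1 := by ring
          _ ≤ _ := by gcongr <;> first | assumption | norm_num
      have e2 : N ^ 4 * M ^ 6 * D ^ 3 ≤ M ^ 10 * N ^ 6 * D ^ 4 := by
        calc N ^ 4 * M ^ 6 * D ^ 3 = M ^ 6 * N ^ 4 * D ^ 3 := by ring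
          _ ≤ _ := by gcongr <;> first | assumption | norm_num
      have e3 : N ^ 4 * M ^ 4 * D ^ 3 ≤ M ^ 10 * N ^ 6 * D ^ 4 := by
        calc N ^ 4 * M ^ 4 * D ^ 3 = M ^ 4 * N ^ 4 * D ^ 3 := by ring
          _ ≤ _ := by gcongr <;> first | assumption | norm_num
      calc _ ≤ 16 * M ^ 2 * (N ^ 2 * M ^ 2 * D / 1 + N ^ 2 * D * (N ^ 2 * M ^ 2 * D ^ 2) *
            (1 * (5 / 2 * M ^ 2 + 10 / 3 / 1))) := by gcongr
        -- The coefficients sum to less than 110, below `121 = 11 ^ 2`, whence the 11 in `K`.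
        _ = 16 * (N ^ 2 * M ^ 4 * D) + 40 * (N ^ 4 * M ^ 6 * D ^ 3) +
            160 / 3 * (N ^ 4 * M ^ 4 * D ^ 3) := by ring
        _ ≤ 121 * (M ^ 10 * N ^ 6 * D ^ 4) := by
          have : 0 ≤ M ^ 10 * N ^ 6 * D ^ 4 := by positivity
          linarith
        _ = _ := by ring
  · intro a b ha hb
    -- `S` collects the coefficients of both conditions, with 54 rounding up `160 / 3`; squaring `S
    -- + 1` rather than `S` ensures the square dominates `S`.
    set S := 5 * b + 16 / a + 40 * a + 54 * (a / b)
    have hS : 0 < S := by positivity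
    refine ⟨(D * (S + 1)) ^ 5, by positivity, ?_⟩
    intro n E _ _ G hC ε hε T hKT Ω _ P _ ℱ x π p h
    by_cases h0 : n = 0 ∨ Fintype.card E * G.cmax = 0 ∨ T = 0
    · exact h.avgExploitabilityLE_of_trivial hε h0
    push Not at h0
    obtain ⟨hn, hmc, hT⟩ := h0
    have hm1 : (1 : ℝ) ≤ Fintype.card E := by
      have : Fintype.card E ≠ 0 := fun h => hmc (by rw [h]; simp)
      exact_mod_cast Nat.one_le_iff_ne_zero.2 this
    have hn1 : (1 : ℝ) ≤ n := by exact_mod_cast Nat.one_le_iff_ne_zero.2 hn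
    have hcD : G.cmax ≤ D := hC.trans (le_max_left _ _)
    have hc : 0 < G.cmax :=
      G.cmax_nonneg.lt_of_ne' fun h => hmc (by rw [h]; simp)
    obtain ⟨M, hM, hmM, hMpow⟩ := Real.exists_pow_eq_rpow 10 (by norm_num) hm1
    obtain ⟨N, hN, hnN, hNpow⟩ := Real.exists_pow_eq_rpow 10 (by norm_num) hn1
    rw [hNpow 65 _ (by norm_num)] at hKT
    have hw := CongestionGame.mul_le_mul_rpow_one_fifth (κ := D * (S + 1))
      (Q := M ^ 14 * N ^ 13) hε (by convert hKT using 3; rw [hmM]; ring)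
    have hα : a * (Fintype.card E : ℝ) ^ (-(4 / 5) : ℝ) * (n : ℝ) ^ (-(8 / 5) : ℝ) * G.cmax⁻¹ =
        a / (M ^ 8 * N ^ 16 * G.cmax) := by
      rw [Real.rpow_neg (by linarith), Real.rpow_neg (by linarith), hMpow 8 _ (by norm_num),
        hNpow 16 _ (by norm_num)]
      field_simp
    have hβ : b * (n : ℝ) ^ (-(6 / 5) : ℝ) * (Fintype.card E : ℝ) ^ (-(11 / 10) : ℝ) =
        b / (N ^ 12 * M ^ 11) := by
      rw [Real.rpow_neg (by linarith), Real.rpow_neg (by linarith), hMpow 11 _ (by norm_num),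
        hNpow 12 _ (by norm_num)]
      field_simp
    have hM0 : 0 < M := by linarith
    have hN0 : 0 < N := by linarith
    refine h.avgExploitabilityLE_of_rpow
      (τ := fun t => b * (n : ℝ) ^ (-(6 / 5) : ℝ) * (Fintype.card E : ℝ) ^ (-(11 / 10) : ℝ) *
        (t : ℝ) ^ (-(1 / 5) : ℝ)) (α := a / (M ^ 8 * N ^ 16 * G.cmax))
      (β := b / (N ^ 12 * M ^ 11)) (by positivity) (by positivity)
      (fun t => by rw [← hα]; rfl) (fun t => by rw [← hβ]) hε (Nat.one_le_iff_ne_zero.2 hT)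
      (le_trans ?_ hw) (le_trans ?_ (pow_le_pow_left₀ (by positivity) hw 2)) <;>
      rw [hmM] <;> try rw [hnN]
    · have hbS : 5 * b ≤ S + 1 := by
        have : 0 < 16 / a + 40 * a + 54 * (a / b) := by positivity
        simp only [S]; linarith
      calc 5 * ((M ^ 10) ^ 2 * G.cmax * (b / (N ^ 12 * M ^ 11)))
          = G.cmax * (5 * b) * (M ^ 9 / N ^ 12) := by field_simp
        _ ≤ D * (S + 1) * (M ^ 14 * N ^ 13) := by
          gcongr
          calc M ^ 9 / N ^ 12 ≤ M ^ 9 := div_le_self (by positivity) (one_le_pow₀ hN)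
            _ = M ^ 9 * 1 := (mul_one _).symm
            _ ≤ _ := by
              gcongr
              · norm_num
              · exact one_le_pow₀ hN
    · have e1 : M ^ 22 * N ^ 4 ≤ M ^ 28 * N ^ 26 := by
        gcongr <;> first | assumption | norm_num
      have e2 : M ^ 23 * N ^ 16 ≤ M ^ 28 * N ^ 26 := by
        gcongr <;> first | assumption | norm_num
      have hSS : 16 / a + 40 * a + 160 / 3 * (a / b) ≤ (S + 1) ^ 2 := by
        have : 0 < a / b := by positivity
        have h1 : 16 / a + 40 * a + 160 / 3 * (a / b) ≤ S := by simp only [S]; linarith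
        nlinarith
      -- The tuned step size makes every term proportional to `cmax ^ 2`. The term from the range of
      -- the potential has the largest powers, exactly the square of `M ^ 14 * N ^ 13`.
      calc _ = G.cmax ^ 2 * (16 / a * (M ^ 28 * N ^ 26) + 40 * a * (M ^ 22 * N ^ 4) +
            160 / 3 * (a / b) * (M ^ 23 * N ^ 16)) := by
            field_simp
            ring
        _ ≤ G.cmax ^ 2 * (16 / a * (M ^ 28 * N ^ 26) + 40 * a * (M ^ 28 * N ^ 26) +
            160 / 3 * (a / b) * (M ^ 28 * N ^ 26)) := by gcongr
        _ = G.cmax ^ 2 * ((16 / a + 40 * a + 160 / 3 * (a / b)) * (M ^ 28 * N ^ 26)) := by ring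
        _ ≤ D ^ 2 * ((S + 1) ^ 2 * (M ^ 28 * N ^ 26)) := by gcongr
        _ = _ := by ring
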